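/- Let $\xi_1,\dots,\xi_n$ be vectors of equal length in the open upper half-plane $\mathbb R\times\mathbb R_{>0}$, going in this order strictly clockwise around the origin, and let $Z_n=\{\sum_i a_i\xi_i : 0\le a_i\le 1\}$ be the zonogon they generate. For $i<j$, an $ij$-tile is a translate of the rhombus $[0,\xi_i]+[0,\xi_j]$. A rhombus tiling $T$ of $Z_n$ is a finite set of tiles with union $Z_n$ such that any two distinct tiles that intersect do so in a single common vertex or a single common closed edge. Let $G_T$ be the directed graph formed by the vertices and edges of the tiles, with edges directed upward; an edge that is a translate of $[0,\xi_i]$ has colour $i$. A snake of $T$ is a maximal directed path in $G_T$, and $\Sigma(T)$ is the set of linear orders $\sigma$ on $[n]=\{1,\dots,n\}$ such that the sequence of edge colours along some snake, read upward, lists the elements of $[n]$ in $\sigma$-increasing order. A set $\mathcal D$ of linear orders on $[n]$ is cyclic if there are three alternatives $i,j,k\in[n]$ and three orders in $\mathcal D$ whose restrictions to $\{i,j,k\}$ are $ijk,\ jki,\ kij$ or $kji,\ jik,\ ikj$. A Condorcet domain is a non-cyclic set of linear orders on $[n]$ that contains the two orders $1<2<\dots<n$ and $n<\dots<2<1$.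 It is complete if it is inclusion-wise maximal, i.e. adding any new linear order makes it cyclic. **Theorem 1.** For every rhombus tiling $T$ of the zonogon $Z_n$, the set $\Sigma(T)$ is a complete Condorcet domain. -/

import Mathlib

namespace CondorcetTiling

/-! ### Linear orders on the set of alternatives and Condorcet domains -/

/-- A (strict) linear order on the set of alternatives `Fin n`; `σ.lt i j` is read `i <_σ j`. -/
@[ext] structure LinOrd (n : ℕ) where
  lt : Fin n → Fin n → Prop
  irrefl : ∀ i, ¬ lt i i
  trans : ∀ i j k, lt i j → lt j k → lt i k
  total : ∀ i j, i ≠ j → lt i j ∨ lt j i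

/-- The natural order `1 < 2 < ... < n`. -/
def LinOrd.alpha (n : ℕ) : LinOrd n where
  lt i j := i < j
  irrefl i := lt_irrefl i
  trans _ _ _ h h' := lt_trans h h'
  total _ _ h := lt_or_gt_of_ne h

/-- The reversed order `n < n - 1 < ... < 1`. -/
def LinOrd.omega (n : ℕ) : LinOrd n where
  lt i j := j < i
  irrefl i := lt_irrefl i
  trans _ _ _ h h' := lt_trans h' h
  total _ _ h := (lt_or_gt_of_ne h).symm

/-- The restriction of `σ` to `{i, j, k}` is the word `ijk`, i.e. `i <_σ j <_σ k`. -/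
def LinOrd.Restricts {n : ℕ} (σ : LinOrd n) (i j k : Fin n) : Prop :=
  σ.lt i j ∧ σ.lt j k

/-- The word `w` encodes `σ`: it lists all alternatives in increasing order. -/
def LinOrd.HasWord {n : ℕ} (σ : LinOrd n) (w : List (Fin n)) : Prop :=
  (∀ i, i ∈ w) ∧ w.Pairwise σ.lt

/-- Some three orders of `D` restrict to `ijk`, `jki`, `kij`. -/
def HasCyclicTriple {n : ℕ} (D : Set (LinOrd n)) (i j k : Fin n) : Prop :=
  (∃ σ ∈ D, σ.Restricts i j k) ∧ (∃ σ ∈ D, σ.Restricts j k i) ∧ (∃ σ ∈ D, σ.Restricts k i j)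

/-- `D` is cyclic: for some three alternatives, three orders of `D` have restrictions
`ijk, jki, kij` or `kji, jik, ikj`. -/
def IsCyclic {n : ℕ} (D : Set (LinOrd n)) : Prop :=
  ∃ i j k : Fin n, HasCyclicTriple D i j k ∨ HasCyclicTriple D k j i

/-- A Condorcet domain: an acyclic set of linear orders. As everywhere in this setting, domains
are understood to contain both distinguished orders `alpha` and `omega`. -/
def IsCondorcetDomain {n : ℕ} (D : Set (LinOrd n)) : Prop :=
  LinOrd.alpha n ∈ D ∧ LinOrd.omega n ∈ D ∧ ¬ IsCyclic D

/-- `D` is complete: adding any new linear order violates acyclicity. -/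
def IsComplete {n : ℕ} (D : Set (LinOrd n)) : Prop :=
  ∀ ρ : LinOrd n, ρ ∉ D → IsCyclic (insert ρ D)

/-! ### The zonogon -/

/-- Vectors `ξ 0, ..., ξ (n - 1)` of equal Euclidean length in the open upper half-plane, going in
this order clockwise around the origin. -/
structure Generators (n : ℕ) where
  ξ : Fin n → ℝ × ℝ
  upper : ∀ i, 0 < (ξ i).2
  same_length : ∀ i j, (ξ i).1 ^ 2 + (ξ i).2 ^ 2 = (ξ j).1 ^ 2 + (ξ j).2 ^ 2
  clockwise : ∀ i j, i < j → (ξ i).1 * (ξ j).2 - (ξ i).2 * (ξ j).1 < 0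

/-- The zonogon: the sum of the segments `[0, ξ i]`. -/
def Generators.zonogon {n : ℕ} (G : Generators n) : Set (ℝ × ℝ) :=
  {p | ∃ a : Fin n → ℝ, (∀ i, 0 ≤ a i ∧ a i ≤ 1) ∧ p = ∑ i, a i • G.ξ i}

/-! ### Edges, tiles, tilings -/

/-- An upward directed edge of colour `color`, starting at the point `tail`. -/
@[ext] structure Edge (n : ℕ) where
  tail : ℝ × ℝ
  color : Fin n

namespace Edge

variable {n : ℕ}

/-- The end point of an edge. -/
def head (G : Generators n) (e : Edge n) : ℝ × ℝ := e.tail + G.ξ e.color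

/-- The closed segment underlying an edge. -/
def carrier (G : Generators n) (e : Edge n) : Set (ℝ × ℝ) := segment ℝ e.tail (e.head G)

end Edge

/-- An `ij`-tile (`i < j`), given by its lowest vertex `base`. -/
@[ext] structure Tile (n : ℕ) where
  base : ℝ × ℝ
  i : Fin n
  j : Fin n
  i_lt_j : i < j

namespace Tile

variable {n : ℕ}

/-- The closed rhombus `base + [0, ξ i] + [0, ξ j]`. -/
def carrier (G : Generators n) (t : Tile n) : Set (ℝ × ℝ) :=
  {p | ∃ a b : ℝ, 0 ≤ a ∧ a ≤ 1 ∧ 0 ≤ b ∧ b ≤ 1 ∧ p = t.base + a • G.ξ t.i + b • G.ξ t.j}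

/-- The four vertices of a tile. -/
def vertices (G : Generators n) (t : Tile n) : Set (ℝ × ℝ) :=
  {t.base, t.base + G.ξ t.i, t.base + G.ξ t.j, t.base + G.ξ t.i + G.ξ t.j}

/-- The four edges of a tile, directed upward. -/
def edges (G : Generators n) (t : Tile n) : Set (Edge n) :=
  {⟨t.base, t.i⟩, ⟨t.base, t.j⟩, ⟨t.base + G.ξ t.i, t.j⟩, ⟨t.base + G.ξ t.j, t.i⟩}

end Tile

/-- A rhombus tiling of the zonogon: finitely many tiles whose union is the zonogon, such that any
two different tiles that meet do so in exactly one common vertex or one common closed edge. -/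
structure Tiling {n : ℕ} (G : Generators n) where
  tiles : Finset (Tile n)
  cover : (⋃ t ∈ tiles, t.carrier G) = G.zonogon
  inter : ∀ t ∈ tiles, ∀ t' ∈ tiles, t ≠ t' → (t.carrier G ∩ t'.carrier G).Nonempty →
    (∃ v ∈ t.vertices G ∩ t'.vertices G, t.carrier G ∩ t'.carrier G = {v}) ∨
    (∃ e ∈ t.edges G ∩ t'.edges G, t.carrier G ∩ t'.carrier G = e.carrier G)

namespace Tiling

variable {n : ℕ} {G : Generators n}

/-- The edges of the directed graph of a tiling. -/
def edges (T : Tiling G) : Set (Edge n) := {e | ∃ t ∈ T.tiles, e ∈ t.edges G}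

/-- Directed paths in the graph of a tiling, as lists of consecutive edges. -/
def IsPath (T : Tiling G) (p : List (Edge n)) : Prop :=
  (∀ e ∈ p, e ∈ T.edges) ∧ p.IsChain (fun e f => e.head G = f.tail)

/-- A snake: a maximal directed path, i.e. one that is not a proper part of a longer one. -/
def IsSnake (T : Tiling G) (p : List (Edge n)) : Prop :=
  T.IsPath p ∧ ∀ q, T.IsPath q → p <:+: q → q = p

/-- The set of linear orders compatible with `T`: those whose word is the sequence of edge colours
along some snake of `T`. -/
def compatibleOrders (T : Tiling G) : Set (LinOrd n) :=
  {σ | ∃ p, T.IsSnake p ∧ σ.HasWord (p.map Edge.color)}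

end Tiling

end CondorcetTiling

open Filter Topology

namespace CondorcetTiling

/-! ### Sides -/

/-! Everything rests on pushing snakes across tiles. An edge not on the `D`-boundary has a unique
tile on side `D` (`boundary_or_tile`, `tile_unique`). Hence a path from `0` to `G.top` either runs
along the `D`-boundary or contains two consecutive edges of a tile that can be replaced by the other
two (`canPush_or_boundary`). A push only swaps two colours, and pushing terminates, so every such
path has the colours of a boundary path: each colour exactly once. Thus snakes are exactly these
paths, both natural orders occur, and the set of colours below a vertex (`content`) does not depend
on the path.

Acyclicity: the edges of colour `j` form one strip of tiles from left to right. Along it the set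
`inverted` of colours whose order relative to `j` is reversed grows, so any two of these sets are
comparable (`inverted_total`). A cyclic triple whose numerically middle element is `j` would give
two incomparable ones.

Completeness: given a new order `ρ`, follow its word upward from `0` in the graph. If the next
colour `i` is not available at the vertex reached, a tile near that vertex supplies an order which,
together with `ρ` and a natural order, is cyclic (`isCyclic_of_stuck`). If this never happens, the
path reaches the top and `ρ` was compatible already. -/

/-- The order in which the colours appear on the left (`true`) or right (`false`) boundary. -/
def natOrd (n : ℕ) (D : Bool) : LinOrd n :=
  match D with
  | true => LinOrd.alpha n
  | false => LinOrd.omega n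

theorem natOrd_not {n : ℕ} {D : Bool} {i j : Fin n} :
    (natOrd n (!D)).lt i j ↔ (natOrd n D).lt j i := by
  cases D <;> exact Iff.rfl

theorem LinOrd.asymm {n : ℕ} (σ : LinOrd n) {i j : Fin n} (h : σ.lt i j) : ¬ σ.lt j i :=
  fun h' => σ.irrefl i (σ.trans _ _ _ h h')

theorem LinOrd.ne {n : ℕ} (σ : LinOrd n) {i j : Fin n} (h : σ.lt i j) : i ≠ j :=
  fun h' => σ.irrefl i (h' ▸ h)

/-- The sign of a side. -/
def sideSign (D : Bool) : ℝ := if D then 1 else -1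

/-- The horizontal unit vector pointing to side `D`. -/
def sideDir (D : Bool) : ℝ × ℝ := (-sideSign D, 0)

theorem sideSign_mul_self (D : Bool) : sideSign D * sideSign D = 1 := by
  cases D <;> simp [sideSign]

namespace Generators

variable {n : ℕ} (G : Generators n)

/-- The linear functional that vanishes on `ξ c` and is positive on side `D` of it. -/
def side (D : Bool) (c : Fin n) : (ℝ × ℝ) →ₗ[ℝ] ℝ :=
  sideSign D • ((G.ξ c).1 • LinearMap.snd ℝ ℝ ℝ - (G.ξ c).2 • LinearMap.fst ℝ ℝ ℝ)

theorem side_apply (D : Bool) (c : Fin n) (x : ℝ × ℝ) :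
    G.side D c x = sideSign D * ((G.ξ c).1 * x.2 - (G.ξ c).2 * x.1) := by
  simp [side]

theorem side_self (D : Bool) (c : Fin n) : G.side D c (G.ξ c) = 0 := by
  rw [side_apply]; ring

theorem side_pos {D : Bool} {c k : Fin n} (h : (natOrd n D).lt k c) :
    0 < G.side D c (G.ξ k) := by
  rw [side_apply]
  cases D
  · have := G.clockwise c k h
    simp only [sideSign]; norm_num; linarith
  · have := G.clockwise k c h
    simp only [sideSign]; norm_num; linarith

theorem side_neg {D : Bool} {c k : Fin n} (h : (natOrd n D).lt c k) :
    G.side D c (G.ξ k) < 0 := by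
  rw [side_apply]
  cases D
  · have := G.clockwise k c h
    simp only [sideSign]; norm_num; linarith
  · have := G.clockwise c k h
    simp only [sideSign]; norm_num; linarith

theorem side_sideDir (D : Bool) (c : Fin n) : G.side D c (sideDir D) = (G.ξ c).2 := by
  rw [side_apply, sideDir]
  linear_combination (G.ξ c).2 * sideSign_mul_self D

/-- Positivity of both coefficients is the point: in the coordinates of a tile, moving towards side
`D` increases the coordinate along its lower `D`-colour and decreases the other one. -/
theorem sideDir_eq {D : Bool} {c d : Fin n} (h : (natOrd n D).lt c d) :
    ∃ α β : ℝ, 0 < α ∧ 0 < β ∧ sideDir D = α • G.ξ c - β • G.ξ d := by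
  have hΔ := G.side_pos h
  have h1 := G.side_apply D d (G.ξ c)
  set Δ := G.side D d (G.ξ c)
  refine ⟨(G.ξ d).2 / Δ, (G.ξ c).2 / Δ, div_pos (G.upper d) hΔ, div_pos (G.upper c) hΔ, ?_⟩
  have hs := sideSign_mul_self D
  ext
  · simp only [sideDir, Prod.fst_sub, Prod.smul_fst, smul_eq_mul]
    field_simp
    rw [h1]
    linear_combination ((G.ξ d).2 * (G.ξ c).1 - (G.ξ c).2 * (G.ξ d).1) * hs
  · simp only [sideDir, Prod.snd_sub, Prod.smul_snd, smul_eq_mul]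
    field_simp
    ring

/-- This is where equal length enters: on an upper half-circle, going clockwise means moving to the
right. It is needed so that a push moves a vertex horizontally in the right direction. -/
theorem fst_lt {i j : Fin n} (h : i < j) : (G.ξ i).1 < (G.ξ j).1 := by
  have h1 := G.clockwise i j h
  have h2 := G.same_length i j
  have hi := G.upper i
  have hj := G.upper j
  by_contra! hle
  rcases le_total 0 (G.ξ j).1 with h0 | h0
  · have : (G.ξ i).2 ≤ (G.ξ j).2 := by
      by_contra! hc; nlinarith
    nlinarith
  · rcases le_total 0 (G.ξ i).1 with h3 | h3
    · nlinarith [mul_nonneg h3 hj.le, mul_nonneg hi.le (neg_nonneg.2 h0)]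
    · have : (G.ξ j).2 ≤ (G.ξ i).2 := by
        by_contra! hc; nlinarith
      nlinarith

theorem sideSign_fst_lt {D : Bool} {i j : Fin n} (h : (natOrd n D).lt i j) :
    sideSign D * (G.ξ i).1 < sideSign D * (G.ξ j).1 := by
  cases D
  · have := G.fst_lt (i := j) (j := i) h
    simp only [sideSign]; norm_num; exact this
  · have := G.fst_lt (i := i) (j := j) h
    simp only [sideSign]; norm_num; exact this

theorem coeff_unique {i j : Fin n} (h : i ≠ j) {a b a' b' : ℝ}
    (he : a • G.ξ i + b • G.ξ j = a' • G.ξ i + b' • G.ξ j) : a = a' ∧ b = b' := by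
  have key : ∀ D : Bool, (natOrd n D).lt i j → a = a' ∧ b = b' := by
    intro D hD
    have h1 := congrArg (G.side D i) he
    have h2 := congrArg (G.side D j) he
    simp only [map_add, map_smul, side_self, smul_eq_mul, mul_zero, zero_add, add_zero] at h1 h2
    exact ⟨mul_right_cancel₀ (G.side_pos hD).ne' h2, mul_right_cancel₀ (G.side_neg hD).ne h1⟩
  rcases lt_or_gt_of_ne h with h | h
  · exact key true h
  · exact key false h

/-! ### The zonogon -/

theorem zonogon_convex : Convex ℝ G.zonogon := by
  rintro x ⟨a, ha, rfl⟩ y ⟨b, hb, rfl⟩ s t hs ht hst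
  refine ⟨fun i => s * a i + t * b i, fun i => ⟨?_, ?_⟩, ?_⟩
  · have := mul_nonneg hs (ha i).1
    have := mul_nonneg ht (hb i).1
    linarith
  · have := mul_le_mul_of_nonneg_left (ha i).2 hs
    have := mul_le_mul_of_nonneg_left (hb i).2 ht
    linarith
  · rw [Finset.smul_sum, Finset.smul_sum, ← Finset.sum_add_distrib]
    exact Finset.sum_congr rfl fun i _ => by rw [add_smul, mul_smul, mul_smul]

/-- The highest vertex of the zonogon. -/
def top : ℝ × ℝ := ∑ i, G.ξ i

theorem zero_mem_zonogon : (0 : ℝ × ℝ) ∈ G.zonogon :=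
  ⟨0, fun _ => by simp, by simp⟩

theorem top_mem_zonogon : G.top ∈ G.zonogon :=
  ⟨1, fun _ => by simp, by simp [top]⟩

theorem snd_sum (a : Fin n → ℝ) : (∑ i, a i • G.ξ i).2 = ∑ i, a i * (G.ξ i).2 := by
  simp [Prod.snd_sum]

theorem snd_nonneg {x : ℝ × ℝ} (hx : x ∈ G.zonogon) : 0 ≤ x.2 := by
  obtain ⟨a, ha, rfl⟩ := hx
  rw [snd_sum]
  exact Finset.sum_nonneg fun i _ => mul_nonneg (ha i).1 (G.upper i).le

theorem eq_zero_of_snd {x : ℝ × ℝ} (hx : x ∈ G.zonogon) (h : x.2 ≤ 0) : x = 0 := by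
  obtain ⟨a, ha, rfl⟩ := hx
  rw [snd_sum] at h
  have hn : ∀ i ∈ Finset.univ, 0 ≤ a i * (G.ξ i).2 :=
    fun i _ => mul_nonneg (ha i).1 (G.upper i).le
  have h0 := (Finset.sum_eq_zero_iff_of_nonneg hn).1 (le_antisymm h (Finset.sum_nonneg hn))
  refine Finset.sum_eq_zero fun i hi => ?_
  have := h0 i hi
  rw [mul_eq_zero, or_iff_left (G.upper i).ne'] at this
  rw [this, zero_smul]

theorem top_sub_mem {x : ℝ × ℝ} (hx : x ∈ G.zonogon) : G.top - x ∈ G.zonogon := by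
  obtain ⟨a, ha, rfl⟩ := hx
  refine ⟨fun i => 1 - a i, fun i => ⟨by linarith [(ha i).2], by linarith [(ha i).1]⟩, ?_⟩
  simp [top, sub_smul]

/-- The tail of the edge of colour `c` on the `D`-boundary of the zonogon. -/
noncomputable def bdTail (D : Bool) (c : Fin n) : ℝ × ℝ :=
  open Classical in ∑ k, (if (natOrd n D).lt k c then (1 : ℝ) else 0) • G.ξ k

theorem bdTail_mem (D : Bool) (c : Fin n) : G.bdTail D c ∈ G.zonogon := by
  classical
  refine ⟨_, fun i => ?_, rfl⟩
  split_ifs <;> norm_num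

theorem side_term_nonneg (D : Bool) (c k : Fin n) {a : ℝ} (ha : 0 ≤ a ∧ a ≤ 1) :
    open Classical in
    0 ≤ ((if (natOrd n D).lt k c then (1 : ℝ) else 0) - a) * G.side D c (G.ξ k) := by
  classical
  split_ifs with h
  · exact mul_nonneg (by linarith [ha.2]) (G.side_pos h).le
  · by_cases hk : k = c
    · rw [hk, side_self, mul_zero]
    · have := ((natOrd n D).total k c hk).resolve_left h
      exact mul_nonneg_of_nonpos_of_nonpos (by linarith [ha.1]) (G.side_neg this).le

theorem side_bdTail_sub (D : Bool) (c : Fin n) (a : Fin n → ℝ) :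
    open Classical in
    G.side D c (G.bdTail D c) - G.side D c (∑ i, a i • G.ξ i) =
      ∑ k, ((if (natOrd n D).lt k c then (1 : ℝ) else 0) - a k) * G.side D c (G.ξ k) := by
  classical
  simp only [bdTail, map_sum, map_smul, smul_eq_mul, sub_mul, Finset.sum_sub_distrib]

/-- A linear functional is maximised on the zonogon term by term: coefficient 1 where it is positive
on `ξ k`, coefficient 0 where it is negative. In case of equality all coefficients except that of
`c` are forced (`coeff_of_side_eq`). -/
theorem side_le (D : Bool) (c : Fin n) {x : ℝ × ℝ} (hx : x ∈ G.zonogon) :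
    G.side D c x ≤ G.side D c (G.bdTail D c) := by
  classical
  obtain ⟨a, ha, rfl⟩ := hx
  rw [← sub_nonneg, side_bdTail_sub]
  exact Finset.sum_nonneg fun k _ => G.side_term_nonneg D c k (ha k)

theorem coeff_of_side_eq {D : Bool} {c : Fin n} {a : Fin n → ℝ}
    (ha : ∀ i, 0 ≤ a i ∧ a i ≤ 1)
    (h : G.side D c (∑ i, a i • G.ξ i) = G.side D c (G.bdTail D c)) {k : Fin n} (hk : k ≠ c) :
    open Classical in a k = if (natOrd n D).lt k c then (1 : ℝ) else 0 := by
  classical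
  have h1 := G.side_bdTail_sub D c a
  rw [h, sub_self] at h1
  have h2 := (Finset.sum_eq_zero_iff_of_nonneg
    fun k _ => G.side_term_nonneg D c k (ha k)).1 h1.symm k (Finset.mem_univ k)
  have h3 : G.side D c (G.ξ k) ≠ 0 := by
    rcases (natOrd n D).total k c hk with h | h
    · exact (G.side_pos h).ne'
    · exact (G.side_neg h).ne
  have := (mul_eq_zero.1 h2).resolve_right h3
  linarith

theorem sum_of_side_eq {D : Bool} {c : Fin n} {a : Fin n → ℝ}
    (ha : ∀ i, 0 ≤ a i ∧ a i ≤ 1)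
    (h : G.side D c (∑ i, a i • G.ξ i) = G.side D c (G.bdTail D c)) :
    ∑ i, a i • G.ξ i = G.bdTail D c + a c • G.ξ c := by
  classical
  rw [← sub_eq_iff_eq_add', bdTail, ← Finset.sum_sub_distrib, Finset.sum_eq_single c]
  · rw [if_neg ((natOrd n D).irrefl c), zero_smul, sub_zero]
  · intro k _ hk
    rw [G.coeff_of_side_eq ha h hk, sub_self]
  · exact fun h => absurd (Finset.mem_univ _) h

/-- A unit edge inside the zonogon that lies on the supporting line is the boundary edge. -/
theorem eq_bdTail {D : Bool} {c : Fin n} {x : ℝ × ℝ} (hx : x ∈ G.zonogon)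
    (hx' : x + G.ξ c ∈ G.zonogon) (h : G.side D c x = G.side D c (G.bdTail D c)) :
    x = G.bdTail D c := by
  obtain ⟨a, ha, rfl⟩ := hx
  obtain ⟨b, hb, hab⟩ := hx'
  have h' : G.side D c (∑ i, b i • G.ξ i) = G.side D c (G.bdTail D c) := by
    rw [← hab, map_add, side_self, add_zero, h]
  rw [G.sum_of_side_eq ha h, G.sum_of_side_eq hb h'] at hab
  have h2 := congrArg Prod.snd hab
  simp only [Prod.snd_add, Prod.smul_snd, smul_eq_mul] at h2
  -- Both ends lie on the boundary segment at positions in `[0, 1]` that differ by 1, so the lower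
  -- one is at position 0.
  have h3 : (a c + 1 - b c) * (G.ξ c).2 = 0 := by linarith
  have h4 := (mul_eq_zero.1 h3).resolve_right (G.upper c).ne'
  have h5 : a c = 0 := by linarith [(ha c).1, (hb c).2]
  rw [G.sum_of_side_eq ha h, h5, zero_smul, add_zero]

/-- One cannot move from the `D`-boundary towards side `D` inside the zonogon. -/
theorem not_mem_of_side_eq {D : Bool} {c : Fin n} {x : ℝ × ℝ} {ε : ℝ} (hε : 0 < ε)
    (h : G.side D c x = G.side D c (G.bdTail D c)) : x + ε • sideDir D ∉ G.zonogon := by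
  intro hx
  have := G.side_le D c hx
  rw [map_add, map_smul, side_sideDir, smul_eq_mul, h] at this
  linarith [mul_pos hε (G.upper c)]

end Generators

/-! ### Tiles -/

namespace Tile

variable {n : ℕ} {G : Generators n}

/-- The colour of the lower edge of a tile on side `D`; the upper one has colour `t.col (!D)`. -/
def col (t : Tile n) (D : Bool) : Fin n := if D then t.i else t.j

theorem col_lt (t : Tile n) (D : Bool) : (natOrd n D).lt (t.col D) (t.col (!D)) := by
  cases D <;> exact t.i_lt_j

/-- The lower edge on side `D`. -/
def lower (t : Tile n) (D : Bool) : Edge n := ⟨t.base, t.col D⟩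

/-- The upper edge on side `D`. -/
def upper (G : Generators n) (t : Tile n) (D : Bool) : Edge n :=
  ⟨t.base + G.ξ (t.col D), t.col (!D)⟩

theorem mem_carrier_iff {t : Tile n} (D : Bool) {x : ℝ × ℝ} :
    x ∈ t.carrier G ↔ ∃ a b : ℝ, 0 ≤ a ∧ a ≤ 1 ∧ 0 ≤ b ∧ b ≤ 1 ∧
      x = t.base + a • G.ξ (t.col D) + b • G.ξ (t.col (!D)) := by
  cases D
  · constructor
    · rintro ⟨a, b, h1, h2, h3, h4, rfl⟩
      exact ⟨b, a, h3, h4, h1, h2, add_right_comm _ _ _⟩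
    · rintro ⟨a, b, h1, h2, h3, h4, rfl⟩
      exact ⟨b, a, h3, h4, h1, h2, add_right_comm _ _ _⟩
  · exact Iff.rfl

theorem coord_unique {t : Tile n} {D : Bool} {a b a' b' : ℝ}
    (h : t.base + a • G.ξ (t.col D) + b • G.ξ (t.col (!D)) =
      t.base + a' • G.ξ (t.col D) + b' • G.ξ (t.col (!D))) : a = a' ∧ b = b' :=
  G.coeff_unique ((natOrd n D).ne (t.col_lt D)) (by simpa [add_assoc] using h)

theorem mem_vertices_iff {t : Tile n} (D : Bool) {x : ℝ × ℝ} :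
    x ∈ t.vertices G ↔ ∃ a b : ℝ, (a = 0 ∨ a = 1) ∧ (b = 0 ∨ b = 1) ∧
      x = t.base + a • G.ξ (t.col D) + b • G.ξ (t.col (!D)) := by
  have key : x ∈ t.vertices G ↔ ∃ a b : ℝ, (a = 0 ∨ a = 1) ∧ (b = 0 ∨ b = 1) ∧
      x = t.base + a • G.ξ t.i + b • G.ξ t.j := by
    simp only [vertices, Set.mem_insert_iff, Set.mem_singleton_iff]
    constructor
    · rintro (rfl | rfl | rfl | rfl)
      · exact ⟨0, 0, by simp⟩
      · exact ⟨1, 0, by simp⟩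
      · exact ⟨0, 1, by simp⟩
      · exact ⟨1, 1, by simp⟩
    · rintro ⟨a, b, rfl | rfl, rfl | rfl, rfl⟩ <;> simp
  rw [key]
  cases D
  · constructor
    · rintro ⟨a, b, h1, h2, rfl⟩
      exact ⟨b, a, h2, h1, add_right_comm _ _ _⟩
    · rintro ⟨a, b, h1, h2, rfl⟩
      exact ⟨b, a, h2, h1, add_right_comm _ _ _⟩
  · exact Iff.rfl

theorem mem_edges_iff {t : Tile n} {e : Edge n} :
    e ∈ t.edges G ↔ ∃ D, e = t.lower D ∨ e = t.upper G D := by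
  simp only [edges, Set.mem_insert_iff, Set.mem_singleton_iff, Bool.exists_bool, lower, upper, col]
  simp
  tauto

theorem lower_mem (t : Tile n) (D : Bool) : t.lower D ∈ t.edges G :=
  mem_edges_iff.2 ⟨D, Or.inl rfl⟩

theorem upper_mem (t : Tile n) (D : Bool) : t.upper G D ∈ t.edges G :=
  mem_edges_iff.2 ⟨D, Or.inr rfl⟩

/-- Lower and upper edges are treated uniformly: `s` is the fixed coordinate along the other colour.
The upper edge on side `D` has colour `t.col (!D)`, hence the flip of the side. -/
theorem exists_of_mem_edges {t : Tile n} {e : Edge n} (he : e ∈ t.edges G) :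
    ∃ (D : Bool) (s : ℝ), (s = 0 ∨ s = 1) ∧ e = ⟨t.base + s • G.ξ (t.col (!D)), t.col D⟩ := by
  obtain ⟨D, rfl | rfl⟩ := mem_edges_iff.1 he
  · exact ⟨D, 0, Or.inl rfl, by simp [lower]⟩
  · exact ⟨!D, 1, Or.inr rfl, by simp [upper]⟩

end Tile

theorem Edge.mem_carrier_iff {n : ℕ} {G : Generators n} {e : Edge n} {x : ℝ × ℝ} :
    x ∈ e.carrier G ↔ ∃ r : ℝ, 0 ≤ r ∧ r ≤ 1 ∧ x = e.tail + r • G.ξ e.color := by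
  rw [Edge.carrier, segment_eq_image', Edge.head]
  simp only [add_sub_cancel_left, Set.mem_image, Set.mem_Icc]
  constructor
  · rintro ⟨r, ⟨h1, h2⟩, rfl⟩; exact ⟨r, h1, h2, rfl⟩
  · rintro ⟨r, h1, h2, rfl⟩; exact ⟨r, ⟨h1, h2⟩, rfl⟩

namespace Tile

variable {n : ℕ} {G : Generators n}

theorem edge_carrier_subset {t : Tile n} {e : Edge n} (he : e ∈ t.edges G) :
    e.carrier G ⊆ t.carrier G := by
  obtain ⟨D, s, hs, rfl⟩ := exists_of_mem_edges he
  intro x hx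
  obtain ⟨r, h1, h2, rfl⟩ := Edge.mem_carrier_iff.1 hx
  refine (mem_carrier_iff D).2 ⟨r, s, h1, h2, ?_, ?_, add_right_comm _ _ _⟩ <;>
    rcases hs with rfl | rfl <;> norm_num

theorem tail_mem_vertices {t : Tile n} {e : Edge n} (he : e ∈ t.edges G) :
    e.tail ∈ t.vertices G := by
  obtain ⟨D, s, hs, rfl⟩ := exists_of_mem_edges he
  exact (mem_vertices_iff D).2 ⟨0, s, Or.inl rfl, hs, by simp⟩

theorem head_mem_vertices {t : Tile n} {e : Edge n} (he : e ∈ t.edges G) :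
    e.head G ∈ t.vertices G := by
  obtain ⟨D, s, hs, rfl⟩ := exists_of_mem_edges he
  exact (mem_vertices_iff D).2 ⟨1, s, Or.inr rfl, hs, by simp [Edge.head, add_right_comm]⟩

theorem vertices_subset {t : Tile n} : t.vertices G ⊆ t.carrier G := by
  intro x hx
  obtain ⟨a, b, ha, hb, rfl⟩ := (mem_vertices_iff true).1 hx
  refine (mem_carrier_iff true).2 ⟨a, b, ?_, ?_, ?_, ?_, rfl⟩ <;>
    rcases ha with rfl | rfl <;> rcases hb with rfl | rfl <;> norm_num

/-- A vertex of a tile lying on an edge of the tile is an end point of that edge. -/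
theorem vertex_on_edge {t : Tile n} {e : Edge n} (he : e ∈ t.edges G) {v : ℝ × ℝ}
    (hv : v ∈ t.vertices G) (hve : v ∈ e.carrier G) : v = e.tail ∨ v = e.head G := by
  obtain ⟨D, s, hs, rfl⟩ := exists_of_mem_edges he
  obtain ⟨a, b, ha, hb, rfl⟩ := (mem_vertices_iff D).1 hv
  obtain ⟨r, h1, h2, hr⟩ := Edge.mem_carrier_iff.1 hve
  dsimp only at hr
  rw [add_right_comm t.base (s • _)] at hr
  obtain ⟨rfl, rfl⟩ := coord_unique hr
  rcases ha with rfl | rfl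
  · left; simp
  · right; simp [Edge.head, add_right_comm]

/-- The midpoint of an edge is not a vertex. -/
theorem mid_not_vertex {t : Tile n} {e : Edge n} (he : e ∈ t.edges G) :
    e.tail + (1 / 2 : ℝ) • G.ξ e.color ∉ t.vertices G := by
  intro hv
  obtain ⟨D, s, hs, rfl⟩ := exists_of_mem_edges he
  obtain ⟨a, b, ha, hb, h⟩ := (mem_vertices_iff D).1 hv
  rw [add_right_comm] at h
  have := (coord_unique h).1
  rcases ha with rfl | rfl <;> norm_num at this

/-- The midpoint of an edge of a tile lies on no other edge of that tile. -/
theorem eq_of_mid_mem {t : Tile n} {e e' : Edge n} (he : e ∈ t.edges G) (he' : e' ∈ t.edges G)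
    (h : e.tail + (1 / 2 : ℝ) • G.ξ e.color ∈ e'.carrier G) : e = e' := by
  obtain ⟨D, s, hs, rfl⟩ := exists_of_mem_edges he
  obtain ⟨D', s', hs', rfl⟩ := exists_of_mem_edges he'
  obtain ⟨r, h1, h2, hr⟩ := Edge.mem_carrier_iff.1 h
  by_cases hD : D' = D
  · subst hD
    simp only [add_right_comm t.base] at hr
    rw [(coord_unique hr).2]
  · obtain rfl : D' = !D := by cases D <;> cases D' <;> simp_all
    simp only [Bool.not_not] at hr
    rw [add_right_comm] at hr
    have := (coord_unique hr).1
    rcases hs' with rfl | rfl <;> norm_num at this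

theorem isClosed_carrier (t : Tile n) : IsClosed (t.carrier G) := by
  have : t.carrier G = (fun q : ℝ × ℝ => t.base + q.1 • G.ξ t.i + q.2 • G.ξ t.j) ''
      (Set.Icc 0 1 ×ˢ Set.Icc 0 1) := by
    ext x
    simp only [carrier, Set.mem_ofPred_eq, Set.mem_image, Set.mem_prod, Set.mem_Icc, Prod.exists]
    constructor
    · rintro ⟨a, b, h1, h2, h3, h4, rfl⟩; exact ⟨a, b, ⟨⟨h1, h2⟩, h3, h4⟩, rfl⟩
    · rintro ⟨a, b, ⟨⟨h1, h2⟩, h3, h4⟩, rfl⟩; exact ⟨a, b, h1, h2, h3, h4, rfl⟩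
  rw [this]
  exact ((isCompact_Icc.prod isCompact_Icc).image (by fun_prop)).isClosed

/-- A tile lies on the inner side of each of its edges. -/
theorem side_le_of_lower {t : Tile n} {D : Bool} {x : ℝ × ℝ} (hx : x ∈ t.carrier G) :
    G.side D (t.lower D).color x ≤ G.side D (t.lower D).color (t.lower D).tail := by
  obtain ⟨a, b, h1, h2, h3, h4, rfl⟩ := (mem_carrier_iff D).1 hx
  simp only [lower, map_add, map_smul, G.side_self, smul_eq_mul, mul_zero, add_zero]
  have := mul_nonneg h3 (neg_nonneg.2 (G.side_neg (t.col_lt D)).le)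
  linarith

theorem side_le_of_upper {t : Tile n} {D : Bool} {x : ℝ × ℝ} (hx : x ∈ t.carrier G) :
    G.side D (t.upper G D).color x ≤ G.side D (t.upper G D).color (t.upper G D).tail := by
  obtain ⟨a, b, h1, h2, h3, h4, rfl⟩ := (mem_carrier_iff D).1 hx
  simp only [upper, map_add, map_smul, G.side_self, smul_eq_mul, mul_zero, add_zero]
  have := mul_le_mul_of_nonneg_right h2 (G.side_pos (t.col_lt D)).le
  linarith

/-- Moving towards side `D` from a point off the two `D`-edges leads into the open tile. -/
theorem eventually_interior (t : Tile n) (D : Bool) {a b : ℝ} (ha : 0 ≤ a) (ha' : a < 1)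
    (hb : 0 < b) (hb' : b ≤ 1) :
    ∀ᶠ ε : ℝ in 𝓝[>] 0, ∃ a' b' : ℝ, 0 < a' ∧ a' < 1 ∧ 0 < b' ∧ b' < 1 ∧
      t.base + a • G.ξ (t.col D) + b • G.ξ (t.col (!D)) + ε • sideDir D =
        t.base + a' • G.ξ (t.col D) + b' • G.ξ (t.col (!D)) := by
  obtain ⟨α, β, hα, hβ, hd⟩ := G.sideDir_eq (t.col_lt D)
  have h1 : ∀ᶠ ε : ℝ in 𝓝[>] 0, a + ε * α < 1 := by
    have : Tendsto (fun ε : ℝ => a + ε * α) (𝓝[>] 0) (𝓝 (a + 0 * α)) :=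
      (Continuous.tendsto (by fun_prop) 0).mono_left nhdsWithin_le_nhds
    exact this.eventually_lt_const (by simpa using ha')
  have h2 : ∀ᶠ ε : ℝ in 𝓝[>] 0, 0 < b - ε * β := by
    have : Tendsto (fun ε : ℝ => b - ε * β) (𝓝[>] 0) (𝓝 (b - 0 * β)) :=
      (Continuous.tendsto (by fun_prop) 0).mono_left nhdsWithin_le_nhds
    exact this.eventually_const_lt (by simpa using hb)
  filter_upwards [h1, h2, self_mem_nhdsWithin] with ε h1 h2 hε
  have hε : 0 < ε := hε
  refine ⟨a + ε * α, b - ε * β, ?_, h1, h2, ?_, ?_⟩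
  · have := mul_pos hε hα; linarith
  · have := mul_pos hε hβ; linarith
  · rw [hd]; module

end Tile

/-! ### Local structure of a tiling -/

namespace Tiling

variable {n : ℕ} {G : Generators n} (T : Tiling G)

theorem carrier_subset {t : Tile n} (ht : t ∈ T.tiles) : t.carrier G ⊆ G.zonogon := by
  rw [← T.cover]
  exact Set.subset_biUnion_of_mem (u := fun t : Tile n => t.carrier G) ht

theorem lower_mem_edges {t : Tile n} (ht : t ∈ T.tiles) (D : Bool) : t.lower D ∈ T.edges :=
  ⟨t, ht, t.lower_mem D⟩

theorem upper_mem_edges {t : Tile n} (ht : t ∈ T.tiles) (D : Bool) : t.upper G D ∈ T.edges :=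
  ⟨t, ht, t.upper_mem D⟩

theorem tail_mem {e : Edge n} (he : e ∈ T.edges) : e.tail ∈ G.zonogon := by
  obtain ⟨t, ht, he⟩ := he
  exact T.carrier_subset ht (Tile.vertices_subset (Tile.tail_mem_vertices he))

theorem head_mem {e : Edge n} (he : e ∈ T.edges) : e.head G ∈ G.zonogon := by
  obtain ⟨t, ht, he⟩ := he
  exact T.carrier_subset ht (Tile.vertices_subset (Tile.head_mem_vertices he))

theorem edges_finite : T.edges.Finite := by
  have : T.edges = ⋃ t ∈ T.tiles, t.edges G := by
    ext e; simp [edges]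
  rw [this]
  refine Set.Finite.biUnion T.tiles.finite_toSet fun t _ => ?_
  simp [Tile.edges]

/-- A point of the open tile `t` lies in no other tile. -/
theorem eq_of_interior {t t' : Tile n} (ht : t ∈ T.tiles) (ht' : t' ∈ T.tiles) (D : Bool)
    {a b : ℝ} (ha : 0 < a) (ha' : a < 1) (hb : 0 < b) (hb' : b < 1)
    (h : t.base + a • G.ξ (t.col D) + b • G.ξ (t.col (!D)) ∈ t'.carrier G) : t = t' := by
  by_contra hne
  set x := t.base + a • G.ξ (t.col D) + b • G.ξ (t.col (!D)) with hx
  have hxt : x ∈ t.carrier G :=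
    (Tile.mem_carrier_iff D).2 ⟨a, b, ha.le, ha'.le, hb.le, hb'.le, rfl⟩
  rcases T.inter t ht t' ht' hne ⟨x, hxt, h⟩ with ⟨v, hv, hv'⟩ | ⟨e, he, he'⟩
  · have hxv : x = v := by
      have : x ∈ ({v} : Set (ℝ × ℝ)) := hv' ▸ ⟨hxt, h⟩
      exact this
    obtain ⟨a', b', h1, h2, h3⟩ := (Tile.mem_vertices_iff D).1 hv.1
    have := (Tile.coord_unique (hx.symm.trans (hxv.trans h3))).1
    rcases h1 with rfl | rfl <;> linarith
  · have hxe : x ∈ e.carrier G := he' ▸ ⟨hxt, h⟩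
    obtain ⟨D', s, hs, rfl⟩ := Tile.exists_of_mem_edges he.1
    obtain ⟨r, h1, h2, hr⟩ := Edge.mem_carrier_iff.1 hxe
    dsimp only at hr
    by_cases hD : D' = D
    · subst hD
      rw [add_right_comm t.base (s • _)] at hr
      have := (Tile.coord_unique (hx.symm.trans hr)).2
      rcases hs with rfl | rfl <;> linarith
    · obtain rfl : D' = !D := by cases D <;> cases D' <;> simp_all
      simp only [Bool.not_not] at hr
      have := (Tile.coord_unique (hx.symm.trans hr)).1
      rcases hs with rfl | rfl <;> linarith

/-- Two tiles into which one enters from a common point towards side `D` coincide. -/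
theorem eq_of_common_point {t t' : Tile n} (ht : t ∈ T.tiles) (ht' : t' ∈ T.tiles) {D : Bool}
    {a b a' b' : ℝ} (ha : 0 ≤ a ∧ a < 1) (hb : 0 < b ∧ b ≤ 1) (ha' : 0 ≤ a' ∧ a' < 1)
    (hb' : 0 < b' ∧ b' ≤ 1)
    (h : t.base + a • G.ξ (t.col D) + b • G.ξ (t.col (!D)) =
      t'.base + a' • G.ξ (t'.col D) + b' • G.ξ (t'.col (!D))) : t = t' := by
  obtain ⟨ε, ⟨c, d, h1, h2, h3, h4, h5⟩, ⟨c', d', h1', h2', h3', h4', h5'⟩⟩ :=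
    ((t.eventually_interior (G := G) D ha.1 ha.2 hb.1 hb.2).and
      (t'.eventually_interior (G := G) D ha'.1 ha'.2 hb'.1 hb'.2)).exists
  refine T.eq_of_interior ht ht' D h1 h2 h3 h4 ?_
  rw [← h5, h, h5']
  exact (Tile.mem_carrier_iff D).2 ⟨c', d', h1'.le, h2'.le, h3'.le, h4'.le, rfl⟩

/-- The vertex of a tile farthest from side `D` is not on the `D`-boundary. -/
theorem side_ne_of_vertex {t : Tile n} (ht : t ∈ T.tiles) (D : Bool) (c : Fin n) :
    G.side D c (t.base + G.ξ (t.col (!D))) ≠ G.side D c (G.bdTail D c) := by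
  intro h
  obtain ⟨ε, ⟨a, b, h1, h2, h3, h4, h5⟩, hε⟩ :=
    ((t.eventually_interior (G := G) D le_rfl one_pos one_pos le_rfl).and
      self_mem_nhdsWithin).exists
  refine G.not_mem_of_side_eq hε h (T.carrier_subset ht ?_)
  rw [zero_smul, one_smul, add_zero] at h5
  rw [h5]
  exact (Tile.mem_carrier_iff D).2 ⟨a, b, h1.le, h2.le, h3.le, h4.le, rfl⟩

/-- The initial part of a segment in the zonogon is met by a tile that contains its origin. -/
theorem exists_tile_towards {x z : ℝ × ℝ} (hx : x ∈ G.zonogon) (hz : z ∈ G.zonogon) :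
    ∃ t ∈ T.tiles, x ∈ t.carrier G ∧ ∃ ε : ℝ, 0 < ε ∧ x + ε • (z - x) ∈ t.carrier G := by
  -- Finitely many tiles cover the segment, so one of them contains points of it arbitrarily close
  -- to `x`; closedness then puts `x` in this tile.
  have h1 : ∃ t ∈ T.tiles, ∃ᶠ ε : ℝ in 𝓝[>] 0, x + ε • (z - x) ∈ t.carrier G := by
    by_contra! hcon
    have h2 := (Filter.eventually_all_finset T.tiles).2 hcon
    have h3 : ∀ᶠ ε : ℝ in 𝓝[>] 0, ε < 1 :=
      (tendsto_id.mono_left nhdsWithin_le_nhds).eventually_lt_const one_pos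
    obtain ⟨ε, ⟨h2, h3⟩, h4⟩ := ((h2.and h3).and self_mem_nhdsWithin).exists
    have h5 : x + ε • (z - x) ∈ G.zonogon :=
      G.zonogon_convex.add_smul_sub_mem hx hz ⟨le_of_lt h4, h3.le⟩
    rw [← T.cover] at h5
    simp only [Set.mem_iUnion] at h5
    obtain ⟨t, ht, h5⟩ := h5
    exact h2 t ht h5
  obtain ⟨t, ht, h⟩ := h1
  refine ⟨t, ht, ?_, ?_⟩
  · refine t.isClosed_carrier.mem_of_frequently_of_tendsto h ?_
    have : Tendsto (fun ε : ℝ => x + ε • (z - x)) (𝓝[>] 0) (𝓝 (x + (0 : ℝ) • (z - x))) :=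
      (Continuous.tendsto (by fun_prop) 0).mono_left nhdsWithin_le_nhds
    simpa using this
  · obtain ⟨ε, h, hε⟩ := (h.and_eventually self_mem_nhdsWithin).exists
    exact ⟨ε, hε, h⟩

/-- An edge of the tiling either lies on the `D`-boundary or has a tile on side `D`. -/
theorem boundary_or_tile {e : Edge n} (he : e ∈ T.edges) (D : Bool) :
    e.tail = G.bdTail D e.color ∨ ∃ t ∈ T.tiles, e = t.lower (!D) ∨ e = t.upper G (!D) := by
  by_cases h : G.side D e.color e.tail = G.side D e.color (G.bdTail D e.color)
  · exact Or.inl (G.eq_bdTail (T.tail_mem he) (T.head_mem he) h)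
  right
  have hlt := lt_of_le_of_ne (G.side_le D e.color (T.tail_mem he)) h
  set m := e.tail + (1 / 2 : ℝ) • G.ξ e.color with hm
  have hme : m ∈ e.carrier G := Edge.mem_carrier_iff.2 ⟨1 / 2, by norm_num, by norm_num, rfl⟩
  obtain ⟨t₀, ht₀, he₀⟩ := he
  have hmt₀ := Tile.edge_carrier_subset he₀ hme
  obtain ⟨t, ht, hmt, ε, hε, hmε⟩ :=
    T.exists_tile_towards (T.carrier_subset ht₀ hmt₀) (G.bdTail_mem D e.color)
  -- The midpoint is not a vertex, so two tiles containing it share an edge through it, and that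
  -- edge can only be `e`.
  have het : e ∈ t.edges G := by
    by_cases heq : t₀ = t
    · exact heq ▸ he₀
    rcases T.inter t₀ ht₀ t ht heq ⟨m, hmt₀, hmt⟩ with ⟨v, hv, hv'⟩ | ⟨e', he', he''⟩
    · have hmv : m ∈ ({v} : Set (ℝ × ℝ)) := hv' ▸ ⟨hmt₀, hmt⟩
      rw [Set.mem_singleton_iff] at hmv
      have : m ∉ t₀.vertices G := Tile.mid_not_vertex he₀
      exact absurd hv.1 (hmv ▸ this)
    · have hme' : m ∈ e'.carrier G := he'' ▸ ⟨hmt₀, hmt⟩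
      rw [Tile.eq_of_mid_mem he₀ he'.1 hme']
      exact he'.2
  -- `G.bdTail D e.color` maximises the functional, so a step towards it crosses strictly to side
  -- `D` of the line of `e`. Hence `e` cannot be a `D`-edge of the tile found.
  have hgt : G.side D e.color e.tail < G.side D e.color (m + ε • (G.bdTail D e.color - m)) := by
    have hms : G.side D e.color m = G.side D e.color e.tail := by
      rw [hm, map_add, map_smul, G.side_self, smul_zero, add_zero]
    rw [map_add, map_smul, map_sub, hms, smul_eq_mul]
    have := mul_pos hε (sub_pos.2 hlt)
    linarith
  refine ⟨t, ht, ?_⟩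
  obtain ⟨D', hD'⟩ := Tile.mem_edges_iff.1 het
  by_cases hD : D' = D
  · subst hD
    exfalso
    rcases hD' with rfl | rfl
    · exact absurd (Tile.side_le_of_lower hmε) (not_le.2 hgt)
    · exact absurd (Tile.side_le_of_upper hmε) (not_le.2 hgt)
  · obtain rfl : D' = !D := by cases D <;> cases D' <;> simp_all
    exact hD'

theorem eq_of_lower_upper {t t' : Tile n} (ht : t ∈ T.tiles) (ht' : t' ∈ T.tiles) {D : Bool}
    (h : t.base + G.ξ (t.col (!D)) = t'.base + G.ξ (t'.col (!D))) : t = t' := by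
  refine T.eq_of_common_point ht ht' (D := D) (a := 0) (b := 1) (a' := 0) (b' := 1)
    ⟨le_rfl, one_pos⟩ ⟨one_pos, le_rfl⟩ ⟨le_rfl, one_pos⟩ ⟨one_pos, le_rfl⟩ ?_
  simpa using h

/-- The tile on side `D` of an edge is unique. -/
theorem tile_unique {t t' : Tile n} (ht : t ∈ T.tiles) (ht' : t' ∈ T.tiles) {D : Bool}
    {e : Edge n} (h : e = t.lower (!D) ∨ e = t.upper G (!D))
    (h' : e = t'.lower (!D) ∨ e = t'.upper G (!D)) : t = t' := by
  -- In either case the midpoint of `e` has tile coordinates from which moving towards `D` enters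
  -- the open tile.
  have key : ∀ {t : Tile n}, (e = t.lower (!D) ∨ e = t.upper G (!D)) →
      ∃ a b : ℝ, (0 ≤ a ∧ a < 1) ∧ (0 < b ∧ b ≤ 1) ∧
        t.base + a • G.ξ (t.col D) + b • G.ξ (t.col (!D)) =
          e.tail + (1 / 2 : ℝ) • G.ξ e.color := by
    rintro t (rfl | rfl)
    · exact ⟨0, 1 / 2, by norm_num, by norm_num, by simp [Tile.lower]⟩
    · exact ⟨1 / 2, 1, by norm_num, by norm_num, by simp [Tile.upper, add_right_comm]⟩
  obtain ⟨a, b, ha, hb, h1⟩ := key h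
  obtain ⟨a', b', ha', hb', h2⟩ := key h'
  exact T.eq_of_common_point ht ht' ha hb ha' hb' (h1.trans h2.symm)

/-- A vertex of one tile that lies in another one is a vertex of the latter. -/
theorem vertex_of_mem {t₀ t : Tile n} (ht₀ : t₀ ∈ T.tiles) (ht : t ∈ T.tiles) {v : ℝ × ℝ}
    (hv : v ∈ t₀.vertices G) (hvt : v ∈ t.carrier G) : v ∈ t.vertices G := by
  by_cases heq : t₀ = t
  · exact heq ▸ hv
  have hvt₀ := Tile.vertices_subset hv
  rcases T.inter t₀ ht₀ t ht heq ⟨v, hvt₀, hvt⟩ with ⟨w, hw, hw'⟩ | ⟨e, he, he'⟩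
  · have : v ∈ ({w} : Set (ℝ × ℝ)) := hw' ▸ ⟨hvt₀, hvt⟩
    rw [Set.mem_singleton_iff] at this
    exact this ▸ hw.2
  · have hve : v ∈ e.carrier G := he' ▸ ⟨hvt₀, hvt⟩
    rcases Tile.vertex_on_edge he.1 hv hve with rfl | rfl
    · exact Tile.tail_mem_vertices he.2
    · exact Tile.head_mem_vertices he.2

/-- A tile met when leaving `v` towards the top has `v` as a vertex and contains a point higher than
`v`. So `v` is not its highest vertex, and one of its edges starts there. -/
theorem exists_up_edge {t₀ : Tile n} (ht₀ : t₀ ∈ T.tiles) {v : ℝ × ℝ} (hv : v ∈ t₀.vertices G)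
    (hne : v ≠ G.top) : ∃ e ∈ T.edges, e.tail = v := by
  have hvZ := T.carrier_subset ht₀ (Tile.vertices_subset hv)
  obtain ⟨t, ht, hvt, ε, hε, h⟩ := T.exists_tile_towards hvZ G.top_mem_zonogon
  have hup : 0 < (G.top - v).2 := by
    by_contra! hle
    exact hne (sub_eq_zero.1 (G.eq_zero_of_snd (G.top_sub_mem hvZ) hle)).symm
  obtain ⟨a, b, ha, hb, hab⟩ := (Tile.mem_vertices_iff true).1 (T.vertex_of_mem ht₀ ht hv hvt)
  obtain ⟨c, d, hc, hc', hd, hd', hcd⟩ := (Tile.mem_carrier_iff true).1 h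
  rcases ha with rfl | rfl
  · rcases hb with rfl | rfl
    · exact ⟨t.lower true, T.lower_mem_edges ht _, by simpa [Tile.lower] using hab.symm⟩
    · exact ⟨t.upper G false, T.upper_mem_edges ht _, by simpa [Tile.upper] using hab.symm⟩
  · rcases hb with rfl | rfl
    · exact ⟨t.upper G true, T.upper_mem_edges ht _, by simpa [Tile.upper] using hab.symm⟩
    · exfalso
      rw [hab] at hcd
      rw [← hab] at hcd
      have h2 := congrArg Prod.snd hcd
      have h3 := congrArg Prod.snd hab
      simp only [Prod.snd_add, Prod.smul_snd, smul_eq_mul, one_mul] at h2 h3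
      have := mul_pos hε hup
      have := mul_le_mul_of_nonneg_right hc' (G.upper (t.col true)).le
      have := mul_le_mul_of_nonneg_right hd' (G.upper (t.col (!true))).le
      linarith

theorem exists_down_edge {t₀ : Tile n} (ht₀ : t₀ ∈ T.tiles) {v : ℝ × ℝ} (hv : v ∈ t₀.vertices G)
    (hne : v ≠ 0) : ∃ e ∈ T.edges, e.head G = v := by
  have hvZ := T.carrier_subset ht₀ (Tile.vertices_subset hv)
  obtain ⟨t, ht, hvt, ε, hε, h⟩ := T.exists_tile_towards hvZ G.zero_mem_zonogon
  have hup : 0 < v.2 := by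
    by_contra! hle
    exact hne (G.eq_zero_of_snd hvZ hle)
  obtain ⟨a, b, ha, hb, hab⟩ := (Tile.mem_vertices_iff true).1 (T.vertex_of_mem ht₀ ht hv hvt)
  obtain ⟨c, d, hc, hc', hd, hd', hcd⟩ := (Tile.mem_carrier_iff true).1 h
  rcases ha with rfl | rfl
  · rcases hb with rfl | rfl
    · exfalso
      have h2 := congrArg Prod.snd hcd
      have h3 := congrArg Prod.snd hab
      simp only [Prod.snd_add, Prod.smul_snd, Prod.snd_sub, Prod.snd_zero, smul_eq_mul,
        zero_mul] at h2 h3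
      have := mul_pos hε hup
      have := mul_nonneg hc (G.upper (t.col true)).le
      have := mul_nonneg hd (G.upper (t.col (!true))).le
      linarith
    · exact ⟨t.lower false, T.lower_mem_edges ht _,
        by simpa [Tile.lower, Edge.head] using hab.symm⟩
  · rcases hb with rfl | rfl
    · exact ⟨t.lower true, T.lower_mem_edges ht _,
        by simpa [Tile.lower, Edge.head] using hab.symm⟩
    · exact ⟨t.upper G true, T.upper_mem_edges ht _,
        by simpa [Tile.upper, Edge.head] using hab.symm⟩

end Tiling

end CondorcetTiling

namespace CondorcetTiling

namespace Tiling

variable {n : ℕ} {G : Generators n} (T : Tiling G)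

/-! ### Directed paths between given points -/

/-- `p` is a directed path from `u` to `v`. -/
def Joins : ℝ × ℝ → List (Edge n) → ℝ × ℝ → Prop
  | u, [], v => u = v
  | u, e :: p, v => e ∈ T.edges ∧ e.tail = u ∧ Joins (e.head G) p v

variable {T}

theorem joins_append {u w : ℝ × ℝ} {p q : List (Edge n)} :
    T.Joins u (p ++ q) w ↔ ∃ v, T.Joins u p v ∧ T.Joins v q w := by
  induction p generalizing u with
  | nil => simp [Joins]
  | cons e p ih => simp only [List.cons_append, Joins, ih]; tauto

theorem joins_singleton {e : Edge n} (he : e ∈ T.edges) : T.Joins e.tail [e] (e.head G) :=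
  ⟨he, rfl, rfl⟩

theorem Joins.append {u v w : ℝ × ℝ} {p q : List (Edge n)} (hp : T.Joins u p v)
    (hq : T.Joins v q w) : T.Joins u (p ++ q) w :=
  joins_append.2 ⟨v, hp, hq⟩

theorem Joins.mem_edges {u v : ℝ × ℝ} {p : List (Edge n)} (h : T.Joins u p v) :
    ∀ e ∈ p, e ∈ T.edges := by
  induction p generalizing u with
  | nil => simp
  | cons e p ih =>
    intro f hf
    rcases List.mem_cons.1 hf with rfl | hf
    · exact h.1
    · exact ih h.2.2 f hf

theorem Joins.isPath {u v : ℝ × ℝ} {p : List (Edge n)} (h : T.Joins u p v) : T.IsPath p := by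
  refine ⟨h.mem_edges, ?_⟩
  induction p generalizing u with
  | nil => exact List.isChain_nil
  | cons e p ih =>
    cases p with
    | nil => exact List.isChain_singleton _
    | cons f p => exact List.isChain_cons_cons.2 ⟨h.2.2.2.1.symm, ih h.2.2⟩

theorem IsPath.joins {e : Edge n} {p : List (Edge n)} (h : T.IsPath (e :: p)) :
    ∃ v, T.Joins e.tail (e :: p) v := by
  induction p generalizing e with
  | nil => exact ⟨_, joins_singleton (h.1 e (by simp))⟩
  | cons f p ih =>
    obtain ⟨h1, h2⟩ := List.isChain_cons_cons.1 h.2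
    obtain ⟨v, hv⟩ := ih (e := f) ⟨fun g hg => h.1 g (List.mem_cons_of_mem _ hg), h2⟩
    exact ⟨v, h.1 e (by simp), rfl, h1 ▸ hv⟩

theorem Joins.add_sum {u v : ℝ × ℝ} {p : List (Edge n)} (h : T.Joins u p v) :
    u + ((p.map Edge.color).map G.ξ).sum = v := by
  induction p generalizing u with
  | nil => simpa [Joins] using h
  | cons e p ih =>
    rw [← ih h.2.2, ← h.2.1]
    simp [Edge.head, add_assoc]

theorem tail_snd_lt (e : Edge n) : e.tail.2 < (e.head G).2 := by
  simpa [Edge.head] using G.upper e.color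

theorem exists_up_edge_of_edge {e : Edge n} (he : e ∈ T.edges) (h : e.head G ≠ G.top) :
    ∃ f ∈ T.edges, f.tail = e.head G := by
  obtain ⟨t, ht, he⟩ := he
  exact T.exists_up_edge ht (Tile.head_mem_vertices he) h

theorem exists_down_edge_of_edge {e : Edge n} (he : e ∈ T.edges) (h : e.tail ≠ 0) :
    ∃ f ∈ T.edges, f.head G = e.tail := by
  obtain ⟨t, ht, he⟩ := he
  exact T.exists_down_edge ht (Tile.tail_mem_vertices he) h

/-- Descending edge by edge must stop, since there are finitely many edges and heights strictly
decrease; it can stop only at `0`. -/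
theorem exists_joins_tail {e : Edge n} (he : e ∈ T.edges) : ∃ p, T.Joins 0 p e.tail := by
  have : Finite T.edges := T.edges_finite
  have wf := Finite.wellFounded_of_trans_of_irrefl
    (InvImage (fun a b : ℝ => a < b) (fun e : T.edges => e.1.tail.2))
  have key : ∀ e : T.edges, ∃ p, T.Joins 0 p e.1.tail := by
    intro e
    induction e using wf.induction with
    | _ e ih =>
      by_cases h0 : e.1.tail = 0
      · exact ⟨[], h0.symm⟩
      obtain ⟨f, hf, hfe⟩ := exists_down_edge_of_edge e.2 h0
      obtain ⟨p, hp⟩ := ih ⟨f, hf⟩ (show f.tail.2 < e.1.tail.2 from hfe ▸ tail_snd_lt f)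
      exact ⟨p ++ [f], hfe ▸ hp.append (joins_singleton hf)⟩
  exact key ⟨e, he⟩

theorem exists_joins_head {e : Edge n} (he : e ∈ T.edges) : ∃ p, T.Joins (e.head G) p G.top := by
  have : Finite T.edges := T.edges_finite
  have wf := Finite.wellFounded_of_trans_of_irrefl
    (InvImage (fun a b : ℝ => b < a) (fun e : T.edges => e.1.tail.2))
  have key : ∀ e : T.edges, ∃ p, T.Joins (e.1.head G) p G.top := by
    intro e
    induction e using wf.induction with
    | _ e ih =>
      by_cases h0 : e.1.head G = G.top
      · exact ⟨[], h0⟩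
      obtain ⟨f, hf, hfe⟩ := exists_up_edge_of_edge e.2 h0
      obtain ⟨p, hp⟩ := ih ⟨f, hf⟩
        (show e.1.tail.2 < f.tail.2 from hfe ▸ tail_snd_lt e.1)
      exact ⟨f :: p, hf, hfe, hp⟩
  exact key ⟨e, he⟩

theorem exists_edge (T : Tiling G) : ∃ e, e ∈ T.edges := by
  have h := G.zero_mem_zonogon
  rw [← T.cover] at h
  simp only [Set.mem_iUnion] at h
  obtain ⟨t, ht, -⟩ := h
  exact ⟨_, T.lower_mem_edges ht true⟩

theorem exists_joins_top (T : Tiling G) : ∃ p, T.Joins 0 p G.top := by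
  obtain ⟨e, he⟩ := T.exists_edge
  obtain ⟨p, hp⟩ := exists_joins_tail he
  obtain ⟨q, hq⟩ := exists_joins_head he
  exact ⟨p ++ e :: q, hp.append ⟨he, rfl, hq⟩⟩

theorem Joins.exists_up {p : List (Edge n)} {v : ℝ × ℝ} (h : T.Joins 0 p v) :
    ∃ q, T.Joins v q G.top := by
  rcases List.eq_nil_or_concat p with rfl | ⟨p, e, rfl⟩
  · obtain rfl : 0 = v := h
    exact T.exists_joins_top
  · rw [List.concat_eq_append] at h
    obtain ⟨w, -, h2⟩ := joins_append.1 h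
    obtain ⟨q, hq⟩ := exists_joins_head h2.1
    obtain rfl : e.head G = v := h2.2.2
    exact ⟨q, hq⟩

/-! ### Pushing a path to one side -/

/-- Two consecutive edges of `p` are the edges of a tile on the side opposite to `D`. -/
def CanPush (T : Tiling G) (D : Bool) (p : List (Edge n)) : Prop :=
  ∃ p₁ p₂, ∃ t ∈ T.tiles, p = p₁ ++ t.lower (!D) :: t.upper G (!D) :: p₂

/-- The path is scanned from its upper end. The last edge off the `D`-boundary must be an upper edge
of its tile on side `D`: otherwise its head would be the corner of that tile farthest from `D` while
lying on the `D`-boundary. Below an upper edge the same corner rules out a boundary edge, so there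
is either the lower edge of the same tile, giving a push, or again an upper edge. The third
alternative records this last state and cannot persist down to `0`. -/
theorem canPush_or {D : Bool} {p : List (Edge n)} {u : ℝ × ℝ} (h : T.Joins u p G.top) :
    T.CanPush D p ∨ (∀ e ∈ p, e.tail = G.bdTail D e.color) ∨
      ∃ p', ∃ t ∈ T.tiles, p = t.upper G (!D) :: p' := by
  induction p generalizing u with
  | nil => right; left; simp
  | cons e p ih =>
    rcases ih h.2.2 with ⟨p₁, p₂, t, ht, rfl⟩ | hB | ⟨p', t, ht, rfl⟩
    · exact Or.inl ⟨e :: p₁, p₂, t, ht, rfl⟩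
    · right
      rcases T.boundary_or_tile h.1 D with hb | ⟨t, ht, rfl | rfl⟩
      · left
        intro f hf
        rcases List.mem_cons.1 hf with rfl | hf
        · exact hb
        · exact hB f hf
      · exfalso
        cases p with
        | nil =>
          have h1 : t.base + G.ξ (t.col (!D)) = G.top := h.2.2
          have h2 := G.top_sub_mem (T.head_mem (T.upper_mem_edges ht (!D)))
          have h3 := G.snd_nonneg h2
          rw [← h1] at h3
          have h4 := G.upper (t.col (!!D))
          simp [Tile.upper, Edge.head] at h3 h4
          linarith
        | cons f p =>
          refine T.side_ne_of_vertex ht D f.color ?_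
          rw [← hB f (by simp), h.2.2.2.1]
          rfl
      · exact Or.inr ⟨p, t, ht, rfl⟩
    · rcases T.boundary_or_tile h.1 D with hb | ⟨t', ht', rfl | rfl⟩
      · exfalso
        refine T.side_ne_of_vertex ht D e.color ?_
        have : t.base + G.ξ (t.col (!D)) = e.head G := h.2.2.2.1
        rw [this, Edge.head, map_add, G.side_self, add_zero, hb]
      · left
        have : t.base + G.ξ (t.col (!D)) = t'.base + G.ξ (t'.col (!D)) := h.2.2.2.1
        obtain rfl := T.eq_of_lower_upper ht ht' this
        exact ⟨[], p', t, ht, rfl⟩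
      · exact Or.inr (Or.inr ⟨_, t', ht', rfl⟩)

theorem canPush_or_boundary {D : Bool} {p : List (Edge n)} (h : T.Joins 0 p G.top) :
    T.CanPush D p ∨ ∀ e ∈ p, e.tail = G.bdTail D e.color := by
  rcases canPush_or (D := D) h with h1 | h1 | ⟨p', t, ht, rfl⟩
  · exact Or.inl h1
  · exact Or.inr h1
  · exfalso
    have h1 : t.base + G.ξ (t.col (!D)) = 0 := h.2.1
    have h2 := G.snd_nonneg (T.tail_mem (T.lower_mem_edges ht D))
    have h3 := congrArg Prod.snd h1
    have h4 := G.upper (t.col (!D))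
    simp only [Prod.snd_add, Prod.snd_zero, Tile.lower] at h2 h3
    linarith

theorem upper_head (t : Tile n) (D : Bool) :
    (t.upper G (!D)).head G = (t.upper G D).head G := by
  simp [Tile.upper, Edge.head, add_right_comm]

theorem joins_tile {t : Tile n} (ht : t ∈ T.tiles) (D D' : Bool) :
    T.Joins t.base [t.lower D, t.upper G D] ((t.upper G D').head G) := by
  refine ⟨T.lower_mem_edges ht D, rfl, T.upper_mem_edges ht D, rfl, ?_⟩
  by_cases h : D = D'
  · rw [h]; rfl
  · obtain rfl : D = !D' := by cases D <;> cases D' <;> simp_all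
    exact upper_head t D'

theorem Joins.push {D : Bool} {p₁ p₂ : List (Edge n)} {t : Tile n} {u v : ℝ × ℝ}
    (ht : t ∈ T.tiles) (h : T.Joins u (p₁ ++ t.lower (!D) :: t.upper G (!D) :: p₂) v) :
    T.Joins u (p₁ ++ t.lower D :: t.upper G D :: p₂) v := by
  obtain ⟨w, h1, h2⟩ := joins_append.1 h
  obtain ⟨-, rfl, -, -, h3⟩ := h2
  exact h1.append ((joins_tile ht D (!D)).append h3)

/-- The number of edges of `T` that start farther to side `D` than `v` does. -/
noncomputable def rank (T : Tiling G) (D : Bool) (v : ℝ × ℝ) : ℕ :=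
  {e ∈ T.edges | sideSign D * e.tail.1 < sideSign D * v.1}.ncard

theorem rank_lt {D : Bool} {e : Edge n} (he : e ∈ T.edges) {v : ℝ × ℝ}
    (h : sideSign D * e.tail.1 < sideSign D * v.1) : T.rank D e.tail < T.rank D v := by
  refine Set.ncard_lt_ncard ?_ (T.edges_finite.subset fun _ h => h.1)
  refine (Set.ssubset_iff_of_subset ?_).2 ⟨e, ⟨he, h⟩, fun h' => lt_irrefl _ h'.2⟩
  exact fun f hf => ⟨hf.1, hf.2.trans h⟩

/-- Push as long as possible. Each push transposes two neighbouring colours and moves a single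
vertex of the path towards side `D`, so the total rank of the tails drops. -/
theorem exists_boundary_path (D : Bool) {p : List (Edge n)} (h : T.Joins 0 p G.top) :
    ∃ q, T.Joins 0 q G.top ∧ (q.map Edge.color).Perm (p.map Edge.color) ∧
      ∀ e ∈ q, e.tail = G.bdTail D e.color := by
  induction hN : (p.map fun e => T.rank D e.tail).sum using Nat.strong_induction_on
    generalizing p with
  | _ N ih =>
    rcases canPush_or_boundary (D := D) h with ⟨p₁, p₂, t, ht, rfl⟩ | hB
    · have h1 := h.push ht
      have hlt : T.rank D (t.upper G D).tail < T.rank D (t.upper G (!D)).tail := by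
        refine rank_lt (T.upper_mem_edges ht D) ?_
        simp only [Tile.upper, Prod.fst_add, mul_add]
        have := G.sideSign_fst_lt (t.col_lt D)
        linarith
      obtain ⟨q, hq, hqp, hqB⟩ := ih _ (by
        rw [← hN]
        simp only [List.map_append, List.map_cons, List.sum_append, List.sum_cons, Tile.lower]
        omega) h1 rfl
      refine ⟨q, hq, hqp.trans ?_, hqB⟩
      simp only [List.map_append, List.map_cons, Tile.lower, Tile.upper, Bool.not_not]
      exact (List.Perm.swap _ _ _).append_left _
    · exact ⟨p, h, List.Perm.refl _, hB⟩

theorem boundary_path_pairwise {D : Bool} {q : List (Edge n)} {u v : ℝ × ℝ} (h : T.Joins u q v)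
    (hB : ∀ e ∈ q, e.tail = G.bdTail D e.color) :
    (q.map Edge.color).Pairwise (natOrd n D).lt := by
  classical
  have : IsTrans (Fin n) (natOrd n D).lt := ⟨(natOrd n D).trans⟩
  rw [← List.isChain_iff_pairwise]
  induction q generalizing u with
  | nil => exact List.isChain_nil
  | cons e q ih =>
    cases q with
    | nil => exact List.isChain_singleton _
    | cons f q =>
      refine List.isChain_cons_cons.2 ⟨?_, ih h.2.2 fun g hg => hB g (List.mem_cons_of_mem _ hg)⟩
      have h1 : f.tail = e.tail + G.ξ e.color := h.2.2.2.1
      rw [hB e (by simp), hB f (by simp)] at h1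
      have h2 := congrArg Prod.snd h1
      simp only [Generators.bdTail, Prod.snd_add, G.snd_sum] at h2
      by_contra hlt
      -- If the colours were not increasing, every colour before `f.color` would be before
      -- `e.color`, and the tail of `f` would be no higher than that of `e`.
      have hle : ∀ k ∈ Finset.univ, (if (natOrd n D).lt k f.color then (1 : ℝ) else 0) *
          (G.ξ k).2 ≤ (if (natOrd n D).lt k e.color then (1 : ℝ) else 0) * (G.ξ k).2 := by
        intro k _
        refine mul_le_mul_of_nonneg_right ?_ (G.upper k).le
        by_cases hk : (natOrd n D).lt k f.color
        · have : (natOrd n D).lt k e.color := by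
            by_cases hef : e.color = f.color
            · rwa [hef]
            · exact (natOrd n D).trans _ _ _ hk
                (((natOrd n D).total _ _ hef).resolve_left hlt)
          rw [if_pos hk, if_pos this]
        · rw [if_neg hk]; split_ifs <;> norm_num
      have := Finset.sum_le_sum hle
      have := G.upper e.color
      linarith

/-- By heights: a missing colour would leave the sum of the distinct colours used strictly below the
top. -/
theorem mem_colors_of_nodup {q : List (Edge n)} (h : T.Joins 0 q G.top)
    (hq : (q.map Edge.color).Nodup) (i : Fin n) : i ∈ q.map Edge.color := by
  classical
  have h1 := congrArg Prod.snd h.add_sum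
  rw [zero_add, ← List.sum_toFinset _ hq] at h1
  by_contra hi
  have hlt : ∑ k ∈ (q.map Edge.color).toFinset, (G.ξ k).2 < ∑ k, (G.ξ k).2 :=
    Finset.sum_lt_sum_of_subset (Finset.subset_univ _) (Finset.mem_univ i)
      (by simpa using hi) (G.upper i) fun k _ _ => (G.upper k).le
  simp only [Generators.top, Prod.snd_sum] at h1
  exact hlt.ne h1

/-- Every path from the bottom to the top uses each colour exactly once. -/
theorem Joins.nodup {p : List (Edge n)} (h : T.Joins 0 p G.top) : (p.map Edge.color).Nodup := by
  obtain ⟨q, hq, hqp, hB⟩ := exists_boundary_path true h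
  exact hqp.nodup_iff.1 ((boundary_path_pairwise hq hB).imp fun h => (natOrd n true).ne h)

theorem Joins.mem_colors {p : List (Edge n)} (h : T.Joins 0 p G.top) (i : Fin n) :
    i ∈ p.map Edge.color :=
  mem_colors_of_nodup h h.nodup i

/-! ### Snakes -/

theorem Joins.isSnake {p : List (Edge n)} (h : T.Joins 0 p G.top) : T.IsSnake p := by
  refine ⟨h.isPath, ?_⟩
  rintro q hq ⟨s, r, rfl⟩
  -- The empty path is an infix of every path, so it has to be excluded before the first and last
  -- edges are examined.
  have hp : p ≠ [] := by
    rintro rfl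
    have h0 : (0 : ℝ × ℝ) = G.top := h
    obtain ⟨e, he⟩ := T.exists_edge
    have h1 := G.snd_nonneg (G.top_sub_mem (T.head_mem he))
    have h2 := G.snd_nonneg (T.tail_mem he)
    have h3 := tail_snd_lt (G := G) e
    rw [← h0] at h1
    simp at h1
    linarith
  have hs : s = [] := by
    rcases List.eq_nil_or_concat s with rfl | ⟨s, f, rfl⟩
    · rfl
    exfalso
    cases p with
    | nil => exact hp rfl
    | cons e p =>
      have h1 : f.head G = e.tail := by
        have := hq.2
        rw [List.concat_eq_append] at this
        simp only [List.append_assoc, List.cons_append, List.nil_append] at this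
        have := List.IsChain.right_of_append this
        exact (List.isChain_cons_cons.1 this).1
      have h2 := G.snd_nonneg (T.tail_mem (hq.1 f (by simp)))
      have h3 := tail_snd_lt (G := G) f
      rw [h1, h.2.1] at h3
      exact absurd h3 (not_lt.2 h2)
  have hr : r = [] := by
    cases r with
    | nil => rfl
    | cons f r =>
      exfalso
      subst hs
      rcases List.eq_nil_or_concat p with rfl | ⟨p, e, rfl⟩
      · exact hp rfl
      rw [List.concat_eq_append] at h hq
      obtain ⟨w, -, h2⟩ := joins_append.1 h
      have h1 : e.head G = f.tail := by
        have := hq.2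
        simp only [List.append_assoc, List.cons_append, List.nil_append] at this
        have := List.IsChain.right_of_append this
        exact (List.isChain_cons_cons.1 this).1
      have h3 := G.snd_nonneg (G.top_sub_mem (T.head_mem (hq.1 f (by simp))))
      have h4 := tail_snd_lt (G := G) f
      have h5 : e.head G = G.top := h2.2.2
      rw [← h1, h5] at h4
      simp only [Prod.snd_sub] at h3
      linarith
  simp [hs, hr]

theorem IsSnake.joins {p : List (Edge n)} (h : T.IsSnake p) : T.Joins 0 p G.top := by
  cases p with
  | nil =>
    obtain ⟨e, he⟩ := T.exists_edge
    have := h.2 [e] (joins_singleton he).isPath (List.nil_infix)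
    exact absurd this (by simp)
  | cons e p =>
    obtain ⟨v, hv⟩ := h.1.joins
    obtain ⟨q, hq⟩ := exists_joins_tail hv.1
    obtain ⟨r, hr⟩ := (hq.append hv).exists_up
    have h1 := (hq.append hv).append hr
    have h2 := h.2 _ h1.isPath ⟨q, r, rfl⟩
    rwa [h2] at h1

end Tiling

/-! ### Words and orders -/

/-- The linear order listing the alternatives as in a given word. -/
def LinOrd.ofWord {n : ℕ} (w : List (Fin n)) (hw : ∀ i, i ∈ w) : LinOrd n where
  lt i j := w.idxOf i < w.idxOf j
  irrefl i := lt_irrefl _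
  trans _ _ _ h h' := lt_trans h h'
  total i j h := by
    refine lt_or_gt_of_ne fun h' => h ?_
    exact (List.idxOf_inj (hw i)).1 h'

theorem LinOrd.ofWord_hasWord {n : ℕ} {w : List (Fin n)} (hw : ∀ i, i ∈ w) (hn : w.Nodup) :
    (LinOrd.ofWord w hw).HasWord w := by
  refine ⟨hw, List.pairwise_iff_getElem.2 fun i j hi hj hij => ?_⟩
  change w.idxOf w[i] < w.idxOf w[j]
  rwa [hn.idxOf_getElem, hn.idxOf_getElem]

theorem LinOrd.HasWord.lt_of_append {n : ℕ} {σ : LinOrd n} {w w' : List (Fin n)}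
    (h : σ.HasWord (w ++ w')) {i j : Fin n} (hi : i ∈ w) (hj : j ∈ w') : σ.lt i j :=
  (List.pairwise_append.1 h.2).2.2 i hi j hj

namespace Tiling

variable {n : ℕ} {G : Generators n} {T : Tiling G}

theorem Joins.exists_order {p : List (Edge n)} (h : T.Joins 0 p G.top) :
    ∃ σ ∈ T.compatibleOrders, σ.HasWord (p.map Edge.color) :=
  ⟨_, ⟨p, h.isSnake, LinOrd.ofWord_hasWord h.mem_colors h.nodup⟩,
    LinOrd.ofWord_hasWord h.mem_colors h.nodup⟩

theorem natOrd_mem (T : Tiling G) (D : Bool) : natOrd n D ∈ T.compatibleOrders := by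
  obtain ⟨p, hp⟩ := T.exists_joins_top
  obtain ⟨q, hq, -, hB⟩ := exists_boundary_path D hp
  exact ⟨q, hq.isSnake, hq.mem_colors, boundary_path_pairwise hq hB⟩

/-! ### Contents of vertices -/

/-- The colours used by paths from the bottom to `v`. -/
def content (T : Tiling G) (v : ℝ × ℝ) : Set (Fin n) :=
  {c | ∃ p, T.Joins 0 p v ∧ c ∈ p.map Edge.color}

/-- A path from bottom to top uses each colour exactly once, so its two parts have complementary
colour sets. Fixing `q` and varying `p` shows that `content` is independent of the path. -/
theorem Joins.mem_iff_notMem {p q : List (Edge n)} {v : ℝ × ℝ} (hp : T.Joins 0 p v)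
    (hq : T.Joins v q G.top) {c : Fin n} :
    c ∈ p.map Edge.color ↔ c ∉ q.map Edge.color := by
  have h := hp.append hq
  have h1 := h.nodup
  have h2 := h.mem_colors c
  rw [List.map_append] at h1 h2
  have h3 := List.disjoint_of_nodup_append h1
  rw [List.mem_append] at h2
  exact ⟨fun h => h3 h, fun h => h2.resolve_right h⟩

theorem Joins.mem_content {p : List (Edge n)} {v : ℝ × ℝ} (hp : T.Joins 0 p v) {c : Fin n} :
    c ∈ T.content v ↔ c ∈ p.map Edge.color := by
  refine ⟨?_, fun h => ⟨p, hp, h⟩⟩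
  rintro ⟨q, hq, hc⟩
  obtain ⟨r, hr⟩ := hp.exists_up
  exact (hp.mem_iff_notMem hr).2 ((hq.mem_iff_notMem hr).1 hc)

theorem mem_content_head {e : Edge n} (he : e ∈ T.edges) {c : Fin n} :
    c ∈ T.content (e.head G) ↔ c ∈ T.content e.tail ∨ c = e.color := by
  obtain ⟨p, hp⟩ := exists_joins_tail he
  rw [hp.mem_content, (hp.append (joins_singleton he)).mem_content]
  simp

theorem color_notMem_content {e : Edge n} (he : e ∈ T.edges) : e.color ∉ T.content e.tail := by
  obtain ⟨p, hp⟩ := exists_joins_tail he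
  obtain ⟨q, hq⟩ := exists_joins_head he
  have h : T.Joins e.tail (e :: q) G.top := ⟨he, rfl, hq⟩
  rw [hp.mem_content, hp.mem_iff_notMem h]
  simp

/-- In the order of a snake, the alternatives before `j` form the content of the lower end of the
`j`-coloured edge of the snake. -/
theorem exists_edge_of_order {σ : LinOrd n} (hσ : σ ∈ T.compatibleOrders) (j : Fin n) :
    ∃ e ∈ T.edges, e.color = j ∧ ∀ c, σ.lt c j ↔ c ∈ T.content e.tail := by
  obtain ⟨p, hp, hw⟩ := hσ
  obtain ⟨e, he, rfl⟩ := List.mem_map.1 (hw.1 j)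
  obtain ⟨p₁, p₂, rfl⟩ := List.append_of_mem he
  refine ⟨e, hp.1.1 e he, rfl, fun c => ?_⟩
  obtain ⟨v, h1, h2⟩ := joins_append.1 hp.joins
  obtain rfl : e.tail = v := h2.2.1
  rw [h1.mem_content]
  rw [List.map_append] at hw
  constructor
  · intro hc
    by_contra hcon
    have := hw.1 c
    rw [List.mem_append, or_iff_right hcon, List.map_cons, List.mem_cons] at this
    rcases this with rfl | h
    · exact σ.irrefl _ hc
    · have h3 := (List.pairwise_append.1 hw.2).2.1
      rw [List.map_cons, List.pairwise_cons] at h3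
      exact σ.asymm hc (h3.1 c h)
  · intro hc
    exact hw.lt_of_append hc (by simp)

/-! ### Strips -/

/-- `e` and `e'` are the left and right edges of the same colour of some tile. -/
def StripStep (T : Tiling G) (e e' : Edge n) : Prop :=
  ∃ t ∈ T.tiles, (e = t.lower true ∧ e' = t.upper G false) ∨
    (e = t.upper G true ∧ e' = t.lower false)

/-- The tile to the right of an edge is unique, and its two left edges have different colours, so
the colour of the edge decides how it is crossed. -/
theorem stripStep_rightUnique : Relator.RightUnique T.StripStep := by
  rintro e e₁ e₂ ⟨t, ht, h⟩ ⟨t', ht', h'⟩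
  obtain rfl := T.tile_unique (D := false) ht ht' (h.imp And.left And.left)
    (h'.imp And.left And.left)
  have hne : t.lower true ≠ t.upper G true := fun h =>
    (natOrd n true).ne (t.col_lt true) (congrArg Edge.color h)
  rcases h with ⟨h1, h2⟩ | ⟨h1, h2⟩ <;> rcases h' with ⟨h3, h4⟩ | ⟨h3, h4⟩
  · rw [h2, h4]
  · exact absurd (h1.symm.trans h3) hne
  · exact absurd (h3.symm.trans h1) hne
  · rw [h2, h4]

/-- The alternatives whose order relative to the colour of `e` is inverted along snakes
through `e`. -/
def inverted (T : Tiling G) (e : Edge n) : Set (Fin n) :=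
  {c | (e.color < c ∧ c ∈ T.content e.tail) ∨ (c < e.color ∧ c ∉ T.content e.tail)}

/-- Crossing an `ij`-tile to the right along colour `i` adds the larger colour `j` to the content of
the tail; along colour `j` it removes the smaller colour `i`. Either way exactly one more colour
becomes inverted. -/
theorem StripStep.inverted_ssubset {e e' : Edge n} (h : T.StripStep e e') :
    T.inverted e ⊂ T.inverted e' := by
  obtain ⟨t, ht, ⟨rfl, rfl⟩ | ⟨rfl, rfl⟩⟩ := h
  · have he := T.lower_mem_edges ht false
    have hc : ∀ c, c ∈ T.content (t.upper G false).tail ↔ c ∈ T.content t.base ∨ c = t.j :=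
      fun c => mem_content_head he
    have hj : t.j ∉ T.content t.base := color_notMem_content he
    refine (Set.ssubset_iff_of_subset ?_).2 ⟨t.j, Or.inl ⟨t.i_lt_j, (hc _).2 (Or.inr rfl)⟩, ?_⟩
    · rintro c (⟨h1, h2⟩ | ⟨h1, h2⟩)
      · exact Or.inl ⟨h1, (hc c).2 (Or.inl h2)⟩
      · refine Or.inr ⟨h1, fun h => ?_⟩
        rcases (hc c).1 h with h | rfl
        · exact h2 h
        · exact lt_asymm t.i_lt_j h1
    · rintro (⟨-, h2⟩ | ⟨h1, -⟩)
      · exact hj h2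
      · exact lt_asymm t.i_lt_j h1
  · have he := T.lower_mem_edges ht true
    have hc : ∀ c, c ∈ T.content (t.upper G true).tail ↔ c ∈ T.content t.base ∨ c = t.i :=
      fun c => mem_content_head he
    have hi : t.i ∉ T.content t.base := color_notMem_content he
    refine (Set.ssubset_iff_of_subset ?_).2 ⟨t.i, Or.inr ⟨t.i_lt_j, hi⟩, ?_⟩
    · rintro c (⟨h1, h2⟩ | ⟨h1, h2⟩)
      · refine Or.inl ⟨h1, ?_⟩
        rcases (hc c).1 h2 with h | rfl
        · exact h
        · exact absurd h1 (lt_asymm t.i_lt_j)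
      · exact Or.inr ⟨h1, fun h => h2 ((hc c).2 (Or.inl h))⟩
    · rintro (⟨h1, -⟩ | ⟨-, h2⟩)
      · exact lt_asymm t.i_lt_j h1
      · exact h2 ((hc _).2 (Or.inr rfl))

/-- Walking left along the strip strictly shrinks the finite set `inverted`, so the walk ends,
necessarily at the left boundary edge of the same colour. -/
theorem reflTransGen_stripStep {e : Edge n} (he : e ∈ T.edges) :
    Relation.ReflTransGen T.StripStep ⟨G.bdTail true e.color, e.color⟩ e := by
  induction hS : T.inverted e using WellFoundedLT.induction generalizing e with
  | _ S ih =>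
    rcases T.boundary_or_tile he true with hb | ⟨t, ht, rfl | rfl⟩
    · rw [← hb]
    · have hs : T.StripStep (t.upper G true) (t.lower false) := ⟨t, ht, Or.inr ⟨rfl, rfl⟩⟩
      exact (ih _ (hS ▸ hs.inverted_ssubset) (T.upper_mem_edges ht true) rfl).tail hs
    · have hs : T.StripStep (t.lower true) (t.upper G false) := ⟨t, ht, Or.inl ⟨rfl, rfl⟩⟩
      exact (ih _ (hS ▸ hs.inverted_ssubset) (T.lower_mem_edges ht true) rfl).tail hs

/-- Both edges are reached from the same boundary edge by deterministic steps, so one is reached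
from the other. -/
theorem inverted_total {e e' : Edge n} (he : e ∈ T.edges) (he' : e' ∈ T.edges)
    (h : e.color = e'.color) :
    T.inverted e ⊆ T.inverted e' ∨ T.inverted e' ⊆ T.inverted e := by
  have key : ∀ {f g : Edge n}, Relation.ReflTransGen T.StripStep f g →
      T.inverted f ⊆ T.inverted g := by
    intro f g h
    induction h with
    | refl => exact subset_rfl
    | tail _ hs ih => exact ih.trans hs.inverted_ssubset.subset
  have h1 := reflTransGen_stripStep he
  rw [h] at h1
  exact (Relation.ReflTransGen.total_of_right_unique stripStep_rightUnique h1
    (reflTransGen_stripStep he')).imp key key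

/-! ### Acyclicity -/

/-- In `σ` the middle alternative `b` precedes `a` and `c`; in `τ` it follows both. Thus the smaller
of `a` and `c` is inverted with `b` only in `σ` and the larger one only in `τ`, against
comparability. -/
theorem not_both_of_between {a b c : Fin n} (h : (a < b ∧ b < c) ∨ (c < b ∧ b < a))
    {σ τ : LinOrd n} (hσ : σ ∈ T.compatibleOrders) (hτ : τ ∈ T.compatibleOrders)
    (h1 : σ.Restricts b c a) (h2 : τ.Restricts c a b) : False := by
  obtain ⟨e, he, hec, hlt⟩ := exists_edge_of_order hσ b
  obtain ⟨e', he', hec', hlt'⟩ := exists_edge_of_order hτ b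
  have hc : c ∉ T.content e.tail := fun h => σ.asymm h1.1 ((hlt c).2 h)
  have ha : a ∉ T.content e.tail :=
    fun h => σ.asymm (σ.trans _ _ _ h1.1 h1.2) ((hlt a).2 h)
  have ha' : a ∈ T.content e'.tail := (hlt' a).1 h2.2
  have hc' : c ∈ T.content e'.tail := (hlt' c).1 (τ.trans _ _ _ h2.1 h2.2)
  have ht := inverted_total he he' (hec.trans hec'.symm)
  simp only [inverted, hec, hec'] at ht
  rcases h with ⟨hab, hbc⟩ | ⟨hcb, hba⟩
  · rcases ht with ht | ht
    · rcases ht (Or.inr ⟨hab, ha⟩) with h | h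
      · exact lt_asymm hab h.1
      · exact h.2 ha'
    · rcases ht (Or.inl ⟨hbc, hc'⟩) with h | h
      · exact hc h.2
      · exact lt_asymm hbc h.1
  · rcases ht with ht | ht
    · rcases ht (Or.inr ⟨hcb, hc⟩) with h | h
      · exact lt_asymm hcb h.1
      · exact h.2 hc'
    · rcases ht (Or.inl ⟨hba, ha'⟩) with h | h
      · exact ha h.2
      · exact lt_asymm hba h.1

theorem not_hasCyclicTriple (i j k : Fin n) : ¬ HasCyclicTriple T.compatibleOrders i j k := by
  rintro ⟨⟨σ₁, h1, hr1⟩, ⟨σ₂, h2, hr2⟩, ⟨σ₃, h3, hr3⟩⟩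
  have hij := σ₁.ne hr1.1
  have hjk := σ₁.ne hr1.2
  have hki := σ₂.ne hr2.2
  -- In each case the numerically middle alternative is first in one of the three words and last in
  -- another. The two inconsistent sign patterns are closed in the same way.
  rcases lt_or_gt_of_ne hij with hij | hij <;> rcases lt_or_gt_of_ne hjk with hjk | hjk <;>
    rcases lt_or_gt_of_ne hki with hki | hki
  · exact not_both_of_between (Or.inl ⟨hij, hjk⟩) h2 h3 hr2 hr3
  · exact not_both_of_between (Or.inl ⟨hij, hjk⟩) h2 h3 hr2 hr3
  · exact not_both_of_between (Or.inl ⟨hki, hij⟩) h1 h2 hr1 hr2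
  · exact not_both_of_between (Or.inr ⟨hki, hjk⟩) h3 h1 hr3 hr1
  · exact not_both_of_between (Or.inl ⟨hjk, hki⟩) h3 h1 hr3 hr1
  · exact not_both_of_between (Or.inr ⟨hij, hki⟩) h1 h2 hr1 hr2
  · exact not_both_of_between (Or.inr ⟨hjk, hij⟩) h2 h3 hr2 hr3
  · exact not_both_of_between (Or.inr ⟨hjk, hij⟩) h2 h3 hr2 hr3

end Tiling

end CondorcetTiling

namespace CondorcetTiling

/-! ### Completeness: following a new order upward through the graph -/

theorem isCyclic_of_hasCyclicTriple {n : ℕ} {D : Set (LinOrd n)} {i j k : Fin n}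
    (h : HasCyclicTriple D i j k) : IsCyclic D :=
  ⟨i, j, k, Or.inl h⟩

theorem LinOrd.exists_min {ρ : LinOrd n} {P : Fin n → Prop} (h : ∃ i, P i) :
    ∃ i, P i ∧ ∀ j, P j → ¬ ρ.lt j i := by
  have : IsTrans (Fin n) ρ.lt := ⟨ρ.trans⟩
  have : Std.Irrefl ρ.lt := ⟨ρ.irrefl⟩
  have wf : WellFounded ρ.lt := Finite.wellFounded_of_trans_of_irrefl _
  exact wf.has_min {i | P i} h

namespace Tiling

variable {n : ℕ} {G : Generators n} {T : Tiling G}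

/-- A vertex on the `D`-boundary has in its content all colours preceding the boundary edge. -/
theorem mem_content_of_boundary {D : Bool} {v : ℝ × ℝ} {p : List (Edge n)} (hp : T.Joins 0 p v)
    {c i : Fin n} (hv : v = G.bdTail D c) (hi : (natOrd n D).lt i c) :
    i ∈ p.map Edge.color := by
  classical
  obtain ⟨q, hq⟩ := hp.exists_up
  have hn : (p.map Edge.color).Nodup := by
    have := (hp.append hq).nodup
    rw [List.map_append] at this
    exact this.of_append_left
  -- The colours of `p` give one representation of `v` as a point of the zonogon; on a supporting
  -- line the coefficients are forced.
  have hs : ∑ k, (if k ∈ p.map Edge.color then (1 : ℝ) else 0) • G.ξ k = v := by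
    rw [← hp.add_sum, zero_add, ← List.sum_toFinset _ hn]
    simp only [ite_smul, one_smul, zero_smul, ← Finset.sum_filter]
    refine Finset.sum_congr ?_ fun _ _ => rfl
    ext k; simp
  have h := G.coeff_of_side_eq (D := D) (c := c)
    (a := fun k => if k ∈ p.map Edge.color then (1 : ℝ) else 0)
    (fun k => by split_ifs <;> norm_num) (by rw [hs, hv]) ((natOrd n D).ne hi)
  rw [if_pos hi] at h
  by_contra hcon
  rw [if_neg hcon] at h
  exact zero_ne_one h

/-- Both orders of the colours of a tile occur, after the content of its lowest vertex and
before the colours missing from its highest vertex. -/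
theorem exists_orders_of_tile {t : Tile n} (ht : t ∈ T.tiles) (D : Bool) {i : Fin n}
    (hi : i ∉ T.content t.base) (h1 : i ≠ t.col D) (h2 : i ≠ t.col (!D)) :
    ∃ σ ∈ T.compatibleOrders, σ.Restricts (t.col D) (t.col (!D)) i := by
  obtain ⟨p, hp⟩ := exists_joins_tail (T.lower_mem_edges ht D)
  obtain ⟨q, hq⟩ := exists_joins_head (T.upper_mem_edges ht D)
  have h := hp.append ((joins_tile ht D D).append hq)
  obtain ⟨σ, hσ, hw⟩ := h.exists_order
  refine ⟨σ, hσ, ?_⟩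
  have hip : i ∉ p.map Edge.color := fun h => hi (hp.mem_content.2 h)
  have hiq : i ∈ q.map Edge.color := by
    have := hw.1 i
    simp only [List.map_append, List.mem_append, List.map_cons, List.map_nil, List.mem_cons,
      List.not_mem_nil, or_false, Tile.lower, Tile.upper] at this
    tauto
  have hp2 := hw.2
  simp only [List.map_append, List.map_cons, Tile.lower, Tile.upper, List.cons_append,
    List.nil_append] at hp2
  have hp3 := (List.pairwise_append.1 hp2).2.1
  rw [List.pairwise_cons, List.pairwise_cons] at hp3
  exact ⟨hp3.1 _ (by simp), hp3.2.1 _ hiq⟩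

/-- The path `p` spells an initial segment of `ρ`. -/
def IsInitial (ρ : LinOrd n) (p : List (Edge n)) : Prop :=
  (p.map Edge.color).Pairwise ρ.lt ∧
    ∀ c ∈ p.map Edge.color, ∀ d, ρ.lt d c → d ∈ p.map Edge.color

/-- If the first alternative `i` outside the content of `v` cannot be followed from `v`, while
there is an edge at `v` whose colour comes after `i` on side `D`, then `ρ` creates a cycle. -/
theorem isCyclic_of_stuck {ρ : LinOrd n} {p : List (Edge n)} {v : ℝ × ℝ} (hp : T.Joins 0 p v)
    (hini : IsInitial ρ p) {i : Fin n} (hi : i ∉ p.map Edge.color)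
    (hmin : ∀ j, j ∉ p.map Edge.color → ¬ ρ.lt j i) (hno : (⟨v, i⟩ : Edge n) ∉ T.edges)
    {D : Bool} (hex : ∃ j, (⟨v, j⟩ : Edge n) ∈ T.edges ∧ (natOrd n D).lt i j) :
    IsCyclic (insert ρ T.compatibleOrders) := by
  have hmono := Set.subset_insert ρ T.compatibleOrders
  have hn : ∀ D, natOrd n D ∈ insert ρ T.compatibleOrders := fun D => hmono (T.natOrd_mem D)
  have hρ := Set.mem_insert ρ T.compatibleOrders
  have hafter : ∀ j, j ∉ p.map Edge.color → j ≠ i → ρ.lt i j := fun j hj hne =>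
    (ρ.total j i hne).resolve_left (hmin j hj)
  have hup : ∀ j, (⟨v, j⟩ : Edge n) ∈ T.edges → j ∉ p.map Edge.color := fun j hj h =>
    color_notMem_content hj (hp.mem_content.2 h)
  -- Among the edges at `v` whose colour comes after `i`, take the one nearest to `i`.
  obtain ⟨j, ⟨hj, hij⟩, hjmin⟩ := LinOrd.exists_min (ρ := natOrd n D) hex
  have hjρ : ρ.lt i j := hafter j (hup j hj) ((natOrd n D).ne hij).symm
  rcases T.boundary_or_tile hj D with hb | ⟨t, ht, h | h⟩
  · exact absurd (mem_content_of_boundary hp hb hij) hi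
  · have hv : v = t.base := congrArg Edge.tail h
    have hjt : j = t.col (!D) := congrArg Edge.color h
    have hk := T.lower_mem_edges ht D
    have hkj := t.col_lt D
    rw [← hjt] at hkj
    have hiv : i ∉ T.content t.base := fun h => hi (hp.mem_content.1 (hv ▸ h))
    rw [Tile.lower, ← hv] at hk
    -- Here `v` is the lowest vertex of `t`. By the choice of `j`, the other lower colour `k = t.col
    -- D` comes before `i`, so `natOrd n D` reads `k i j` while `ρ` begins with `i`. The tile
    -- supplies both `k j i` and `j k i`, one of which completes a cycle.
    have hki : (natOrd n D).lt (t.col D) i := by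
      refine ((natOrd n D).total _ _ fun h : t.col D = i => hno (h ▸ hk)).resolve_right fun h => ?_
      exact hjmin _ ⟨hk, h⟩ hkj
    have hkρ : ρ.lt i (t.col D) := hafter _ (hup _ hk) ((natOrd n D).ne hki)
    have hne : i ≠ t.col D := ((natOrd n D).ne hki).symm
    have hne' : i ≠ t.col (!D) := hjt ▸ (natOrd n D).ne hij
    obtain ⟨σ, hσ, hσr⟩ := exists_orders_of_tile ht D hiv hne hne'
    obtain ⟨τ, hτ, hτr⟩ := exists_orders_of_tile ht (!D) hiv hne' (by rwa [Bool.not_not])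
    rw [Bool.not_not] at hτr
    rw [← hjt] at hσr hτr
    rcases ρ.total _ _ ((natOrd n D).ne hkj) with hkj' | hkj'
    · exact isCyclic_of_hasCyclicTriple ⟨⟨ρ, hρ, hkρ, hkj'⟩, ⟨σ, hmono hσ, hσr⟩,
        ⟨natOrd n (!D), hn _, natOrd_not.2 hij, natOrd_not.2 hki⟩⟩
    · exact isCyclic_of_hasCyclicTriple ⟨⟨ρ, hρ, hjρ, hkj'⟩, ⟨τ, hmono hτ, hτr⟩,
        ⟨natOrd n D, hn _, hki, hij⟩⟩
  · have hv : v = t.base + G.ξ (t.col (!D)) := congrArg Edge.tail h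
    have hjt : j = t.col D := by
      have : j = t.col (!!D) := congrArg Edge.color h
      rwa [Bool.not_not] at this
    have hjq := t.col_lt D
    rw [← hjt] at hjq
    have hlow := T.lower_mem_edges ht (!D)
    have hqv : ∀ c, c ∈ p.map Edge.color ↔ c ∈ T.content t.base ∨ c = t.col (!D) := fun c => by
      rw [← hp.mem_content, hv]
      exact mem_content_head hlow
    have hiv : i ∉ T.content t.base := fun h => hi ((hqv i).2 (Or.inl h))
    have hqp : t.col (!D) ∈ p.map Edge.color := (hqv _).2 (Or.inr rfl)
    -- Here `q = t.col (!D)` lies just below `v`, so `ρ` reads `q i j`, while `natOrd n D` reads `i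
    -- j q` and the tile supplies `j q i`.
    have hiq := (natOrd n D).trans _ _ _ hij hjq
    have hqi : ρ.lt (t.col (!D)) i :=
      (ρ.total _ _ ((natOrd n D).ne hiq).symm).resolve_right fun h =>
        hi (hini.2 _ hqp i h)
    obtain ⟨σ, hσ, hσr⟩ := exists_orders_of_tile ht D hiv (hjt ▸ (natOrd n D).ne hij)
      ((natOrd n D).ne hiq)
    rw [← hjt] at hσr
    exact isCyclic_of_hasCyclicTriple ⟨⟨natOrd n D, hn _, hij, hjq⟩, ⟨σ, hmono hσ, hσr⟩,
      ⟨ρ, hρ, hqi, hjρ⟩⟩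

/-- A path spelling an initial segment of `ρ` is extended one colour at a time until it reaches the
top. Colours do not repeat, so length `n + 1` is impossible and the top is reached. -/
theorem mem_of_not_isCyclic {ρ : LinOrd n} (hρ : ¬ IsCyclic (insert ρ T.compatibleOrders)) :
    ρ ∈ T.compatibleOrders := by
  have key : ∀ k : ℕ, ρ ∈ T.compatibleOrders ∨
      ∃ p v, T.Joins 0 p v ∧ IsInitial ρ p ∧ p.length = k := by
    intro k
    induction k with
    | zero => exact Or.inr ⟨[], 0, rfl, by simp [IsInitial], rfl⟩
    | succ k ih =>
      rcases ih with h | ⟨p, v, hp, hini, hk⟩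
      · exact Or.inl h
      obtain ⟨q, hq⟩ := hp.exists_up
      cases q with
      | nil =>
        obtain rfl : v = G.top := hq
        exact Or.inl ⟨p, hp.isSnake, hp.mem_colors, hini.1⟩
      | cons e q =>
        right
        have he : e.color ∉ p.map Edge.color := by
          rw [hp.mem_iff_notMem hq]; simp
        obtain ⟨i, hi, hmin⟩ := LinOrd.exists_min (ρ := ρ) (P := fun c => c ∉ p.map Edge.color)
          ⟨_, he⟩
        have hedge : (⟨v, i⟩ : Edge n) ∈ T.edges := by
          by_contra hno
          obtain ⟨he1, rfl, -⟩ := hq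
          have hne : i ≠ e.color := fun h => hno (h ▸ he1)
          -- Some edge leaves `v`, and its colour differs from `i`; the side `D` is chosen so that
          -- this colour comes after `i`.
          rcases lt_or_gt_of_ne hne with h | h
          · exact hρ (isCyclic_of_stuck (D := true) hp hini hi hmin hno ⟨e.color, he1, h⟩)
          · exact hρ (isCyclic_of_stuck (D := false) hp hini hi hmin hno ⟨e.color, he1, h⟩)
        refine ⟨p ++ [⟨v, i⟩], _, hp.append (joins_singleton hedge), ⟨?_, ?_⟩, by simp [hk]⟩
        · rw [List.map_append, List.pairwise_append]
          refine ⟨hini.1, by simp, fun c hc d hd => ?_⟩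
          obtain rfl : d = i := by simpa using hd
          refine (ρ.total c d fun h => hi (h ▸ hc)).resolve_right fun h => hi (hini.2 c hc d h)
        · intro c hc d hd
          rw [List.map_append, List.mem_append] at hc ⊢
          left
          rcases hc with hc | hc
          · exact hini.2 c hc d hd
          · obtain rfl : c = i := by simpa using hc
            by_contra hcon
            exact hmin d hcon hd
  rcases key (n + 1) with h | ⟨p, v, hp, -, hk⟩
  · exact h
  · exfalso
    obtain ⟨q, hq⟩ := hp.exists_up
    have h := (hp.append hq).nodup.length_le_card
    simp at h
    omega

end Tiling

end CondorcetTiling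

theorem theorem1 {n : ℕ} (G : CondorcetTiling.Generators n) (T : CondorcetTiling.Tiling G) :
    CondorcetTiling.IsCondorcetDomain T.compatibleOrders ∧
      CondorcetTiling.IsComplete T.compatibleOrders := by
  refine ⟨⟨T.natOrd_mem true, T.natOrd_mem false, ?_⟩, fun ρ hρ => ?_⟩
  · rintro ⟨i, j, k, h | h⟩
    · exact CondorcetTiling.Tiling.not_hasCyclicTriple i j k h
    · exact CondorcetTiling.Tiling.not_hasCyclicTriple k j i h
  · by_contra hcon
    exact hρ (CondorcetTiling.Tiling.mem_of_not_isCyclic hcon)
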